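/- Let $d,L\ge 1$ be integers and let $\Lambda_L=(\mathbb Z/L\mathbb Z)^d$ be the periodic box of side length $L$; write $x\sim y$ if $x\neq y$ are nearest neighbours, i.e. $x-y=\pm e_i$ for some standard unit vector $e_i$. On the Hilbert space $\mathcal H=\bigotimes_{x\in\Lambda_L}\ell^2(\mathbb N)$, with bosonic annihilation and creation operators $a_x,a_x^\dagger$ and number operators $n_x=a_x^\dagger a_x$, consider the Bose–Hubbard Hamiltonian $$H=-J\sum_{x\sim y}a_x^\dagger a_y+\frac U2\sum_{x\in\Lambda_L}n_x(n_x-1)-\mu\sum_{x\in\Lambda_L}n_x$$ (the first sum runs over ordered pairs), taken on its maximal domain, with $J\in\mathbb R$, $U>0$ and $\mu>0$. Let $A\subset\Lambda_L$ be a slab of width $L_A\in\{1,\dots,L\}$ orthogonal to a coordinate direction, i.e. $A=\{x: x_j\in\{s,s+1,\dots,s+L_A-1\}\}$ for some $j$ and some $s\in\mathbb Z/L\mathbb Z$, and let $B=\Lambda_L\setminus A$. Then for every $\beta>0$ the operator $e^{-\beta H}$ is trace class, so that the Gibbs state $\rho=e^{-\beta H}/\operatorname{tr}e^{-\beta H}$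 is well defined. Moreover, with $\rho_A$, $\rho_B$ the reduced density matrices obtained from $\rho$ by the partial trace over the sites of $B$ and of $A$, respectively, and $S(\sigma)=-\operatorname{tr}(\sigma\ln\sigma)$, the entropies $S(\rho)$, $S(\rho_A)$, $S(\rho_B)$ are finite, and the mutual information $I(A:B)=S(\rho_A)+S(\rho_B)-S(\rho)$ satisfies $$I(A:B)\le c(J,U,\mu)\,\max\{1,\beta\}\,L^{d-1},$$ where, with $G=2d|J|+1+\mu$, $$c(J,U,\mu)=16|J|\left(\frac{16+4\cdot 6^{2(d-1)}(e-1)^{-2}}{2G}+\frac{U}{16\,G}+\frac{G}{U}+\frac12\right).$$ -/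

import Mathlib

noncomputable section

namespace BoseHubbard

open scoped ENNReal

/-! ### Operators on `ℓ²(κ)`: trace, entropy, thermal states -/

/-- The complex Hilbert space `ℓ²(κ)`. -/
abbrev L2 (κ : Type) : Type := lp (fun _ : κ => ℂ) 2

/-- Trace `∑ₖ ⟨δₖ, T δₖ⟩ ∈ [0, ∞]` of a positive bounded operator on `ℓ²(κ)`.
It is only applied to positive operators. -/
def posTrace {κ : Type} (T : L2 κ →L[ℂ] L2 κ) : ℝ≥0∞ :=
  open Classical in
  ∑' k : κ, ENNReal.ofReal (T (lp.single 2 k (1 : ℂ)) k).re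

/-- The operator `-T ln T` for a positive bounded operator `T` on a Hilbert space, by the continuous
functional calculus for `t ↦ -t ln t` (which is `0` at `t = 0`). -/
def opNegMulLog {E : Type} [NormedAddCommGroup E] [InnerProductSpace ℂ E] [CompleteSpace E]
    (T : E →L[ℂ] E) : E →L[ℂ] E :=
  cfc (p := IsSelfAdjoint) Real.negMulLog T

/-- The von Neumann entropy `S(ρ) = tr(-ρ ln ρ) ∈ [0, ∞]` of a density matrix `ρ`. -/
def entropy {κ : Type} (ρ : L2 κ →L[ℂ] L2 κ) : ℝ≥0∞ :=
  posTrace (opNegMulLog ρ)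

/-- `T = e^{-βH}` for an unbounded operator `H` with an orthonormal basis of eigenvectors in its
domain: `H bᵢ = εᵢ bᵢ` and `T bᵢ = e^{-βεᵢ} bᵢ`. -/
def IsHeatOperator {κ : Type} (H : L2 κ →ₗ.[ℂ] L2 κ) (β : ℝ) (T : L2 κ →L[ℂ] L2 κ) : Prop :=
  ∃ (ι : Type) (b : HilbertBasis ι ℂ (L2 κ)) (ε : ι → ℝ), ∀ i,
    (∃ h : b i ∈ H.domain, H ⟨b i, h⟩ = (ε i : ℂ) • b i) ∧
    T (b i) = (Real.exp (-β * ε i) : ℂ) • b i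

/-- `ρ = e^{-βH} / tr e^{-βH}`, where `tr e^{-βH} < ∞`. -/
def IsGibbsState {κ : Type} (H : L2 κ →ₗ.[ℂ] L2 κ) (β : ℝ) (ρ : L2 κ →L[ℂ] L2 κ) : Prop :=
  ∃ T : L2 κ →L[ℂ] L2 κ, IsHeatOperator H β T ∧ posTrace T ≠ ∞ ∧
    ρ = (((posTrace T).toReal⁻¹ : ℝ) : ℂ) • T

/-! ### Bosons on a set of sites -/

/-- Bosonic Hilbert space `⨂_{x ∈ S} ℓ²(ℕ)` of a finite set `S` of sites, in the occupation number
representation: the product basis vectors are labelled by the configurations `S → ℕ`. -/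
abbrev Fock (S : Type) : Type := L2 (S → ℕ)

section Reduced

variable {S : Type}

/-- The configuration on `S` equal to `k` on `X` and to `m` off `X`. -/
def glue (X : Set S) (m : {x // x ∉ X} → ℕ) (k : X → ℕ) : S → ℕ := fun x =>
  open Classical in
  if h : x ∈ X then k ⟨x, h⟩ else m ⟨x, h⟩

theorem glue_injective (X : Set S) (m : {x // x ∉ X} → ℕ) : Function.Injective (glue X m) := by
  intro k k' h
  funext x
  have := congrFun h x.1
  simpa [glue] using this

theorem sum_norm_rpow_comp_le {κ κ' : Type} (f : κ' → κ) (hf : Function.Injective f) (ψ : L2 κ)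
    (s : Finset κ') : ∑ k ∈ s, ‖ψ (f k)‖ ^ (2 : ℝ≥0∞).toReal ≤ ‖ψ‖ ^ (2 : ℝ≥0∞).toReal := by
  have := lp.sum_rpow_le_norm_rpow (p := 2) (by norm_num) ψ (s.map ⟨f, hf⟩)
  simpa using this

/-- The partial inner product with the product basis vector `δ_m` of the sites off `X`, i.e. the map
`1 ⊗ ⟨δ_m, ·⟩ : Fock S → Fock X`, `ψ ↦ (k ↦ ψ (k on X, m off X))`. -/
def slice (X : Set S) (m : {x // x ∉ X} → ℕ) : Fock S →L[ℂ] Fock X :=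
  LinearMap.mkContinuous
    { toFun := fun ψ => ⟨fun k => ψ (glue X m k),
        memℓp_gen' (sum_norm_rpow_comp_le _ (glue_injective X m) ψ)⟩
      map_add' := fun _ _ => rfl
      map_smul' := fun _ _ => rfl }
    1
    (fun ψ => by
      rw [one_mul]
      exact lp.norm_le_of_forall_sum_le (by norm_num) (norm_nonneg _)
        (sum_norm_rpow_comp_le _ (glue_injective X m) ψ))

/-- The reduced density matrix `ρ_X = ∑_m (1 ⊗ ⟨δ_m|) ρ (1 ⊗ |δ_m⟩)`: the partial trace of `ρ` over
the sites off `X`.  For a density matrix `ρ` the series converges absolutely in operator norm. -/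
def reduced (X : Set S) (ρ : Fock S →L[ℂ] Fock S) : Fock X →L[ℂ] Fock X :=
  ∑' m : {x // x ∉ X} → ℕ, slice X m ∘L ρ ∘L (slice X m).adjoint

/-- The mutual information `I(A:B) = S(ρ_A) + S(ρ_B) - S(ρ_{AB})`, where `B` is the complement of
`A`; meaningful when the three entropies are finite. -/
def mutualInformation (A : Set S) (ρ : Fock S →L[ℂ] Fock S) : ℝ :=
  (entropy (reduced A ρ)).toReal + (entropy (reduced Aᶜ ρ)).toReal - (entropy ρ).toReal

end Reduced

section Ladder

variable {S : Type} [DecidableEq S]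

/-- Annihilation operator on wave functions of the configuration, `a_x δ_n = √n_x δ_{n - e_x}`. -/
def annih (x : S) : Module.End ℂ ((S → ℕ) → ℂ) where
  toFun ψ := fun n => (Real.sqrt (n x + 1) : ℂ) * ψ (n + Pi.single x 1)
  map_add' ψ φ := by funext n; simp [mul_add]
  map_smul' c ψ := by funext n; simp [mul_left_comm]

/-- Creation operator on wave functions of the configuration, `a†_x δ_n = √(n_x + 1) δ_{n + e_x}`
(for `n x = 0` the truncated subtraction is harmless, the coefficient being zero). -/
def creat (x : S) : Module.End ℂ ((S → ℕ) → ℂ) where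
  toFun ψ := fun n => (Real.sqrt (n x) : ℂ) * ψ (n - Pi.single x 1)
  map_add' ψ φ := by funext n; simp [mul_add]
  map_smul' c ψ := by funext n; simp [mul_left_comm]

/-- Number operator `n_x = a†_x a_x`. -/
def num (x : S) : Module.End ℂ ((S → ℕ) → ℂ) := creat x * annih x

/-- The Bose-Hubbard expression on a finite graph,
`-J ∑_{x ∼ y} a†_x a_y + (U/2) ∑_x n_x (n_x - 1) - μ ∑_x n_x`;
the first sum is over ordered pairs of adjacent sites. -/
def hamiltonianExpr [Fintype S] (G : SimpleGraph S) (J U μ : ℝ) :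
    Module.End ℂ ((S → ℕ) → ℂ) :=
  open Classical in
  (-J : ℂ) • (∑ x, ∑ y, if G.Adj x y then creat x * annih y else 0)
    + (U / 2 : ℂ) • (∑ x, num x * (num x - 1))
    - (μ : ℂ) • ∑ x, num x

/-- The Bose-Hubbard Hamiltonian as an unbounded operator on the Hilbert space, on the largest
domain `{ψ ∈ Fock S | Hψ ∈ Fock S}`. -/
def hamiltonian [Fintype S] (G : SimpleGraph S) (J U μ : ℝ) : Fock S →ₗ.[ℂ] Fock S where
  domain :=
    { carrier := {ψ | Memℓp (hamiltonianExpr G J U μ (ψ : (S → ℕ) → ℂ)) 2}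
      add_mem' := fun {ψ φ} hψ hφ => by
        have := Memℓp.add hψ hφ
        simpa only [Set.mem_ofPred_eq, lp.coeFn_add, map_add] using this
      zero_mem' := by
        simpa only [Set.mem_ofPred_eq, lp.coeFn_zero, map_zero] using zero_memℓp
      smul_mem' := fun c ψ hψ => by
        have := Memℓp.const_smul hψ c
        simpa only [Set.mem_ofPred_eq, lp.coeFn_smul, map_smul] using this }
  toFun :=
    { toFun := fun ψ => ⟨hamiltonianExpr G J U μ (ψ.1 : (S → ℕ) → ℂ), ψ.2⟩
      map_add' := fun ψ φ => by
        apply Subtype.ext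
        exact map_add (hamiltonianExpr G J U μ) (ψ.1 : (S → ℕ) → ℂ) (φ.1 : (S → ℕ) → ℂ)
      map_smul' := fun c ψ => by
        apply Subtype.ext
        exact map_smul (hamiltonianExpr G J U μ) c (ψ.1 : (S → ℕ) → ℂ) }

end Ladder

/-! ### The periodic box -/

/-- The `d`-dimensional box of side length `L` with periodic boundary conditions. -/
abbrev Box (d L : ℕ) : Type := Fin d → ZMod L

/-- Nearest neighbours in the periodic box: distinct sites that differ by a unit vector. -/
def boxGraph (d L : ℕ) : SimpleGraph (Box d L) :=
  SimpleGraph.fromRel fun x y => ∃ i, y = x + Pi.single i 1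

/-- The slab of width `w` orthogonal to direction `j`, with first layer at `s`. -/
def slab {d L : ℕ} (j : Fin d) (s : ZMod L) (w : ℕ) : Set (Box d L) :=
  {x | (x j - s).val < w}

/-- The constant of the area law. -/
def areaConst (d : ℕ) (J U μ : ℝ) : ℝ :=
  16 * |J| *
    ((16 + 4 * 6 ^ (2 * (d - 1)) * ((Real.exp 1 - 1) ^ 2)⁻¹) / (2 * (2 * d * |J| + 1 + μ))
      + 1 / 16 * (U / (2 * d * |J| + 1 + μ))
      + (2 * d * |J| + 1 + μ) / U
      + 1 / 2)

end BoseHubbard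

end

noncomputable section

namespace BoseHubbard

open scoped ENNReal ComplexConjugate InnerProductSpace

/-!
A Gibbs state satisfies `S(ρ) = β E(ρ) + log Z`, while `S(σ) ≤ β E(σ) + log Z` for every state `σ`.
For `σ = ρ_A ⊗ ρ_B` the left-hand side is `S(ρ_A) + S(ρ_B)`, so `I(A:B) ≤ β (E(σ) - E(ρ))`. The two
energies differ only in the hopping terms across the boundary: these vanish in `σ`, which conserves
the number of particles in `A`, and are at most the particle density `n` in `ρ`. The density is
controlled by playing the on-site repulsion against the entropy: `β E(ρ) ≤ S(ρ)` because the empty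
configuration has energy `0` and hence `Z ≥ 1`; here `S(ρ)` is at most `log 2 · (n + 1)` per site,
whereas `E(ρ)` grows quadratically in `n`.
-/

/-! ### Positive operators and orthonormal bases -/

section Series

variable {ι : Type*}

theorem hasSum_of_tsum_ofReal_eq {f : ι → ℝ} {t : ℝ} (hf : ∀ i, 0 ≤ f i) (ht : 0 ≤ t)
    (h : ∑' i, ENNReal.ofReal (f i) = ENNReal.ofReal t) : HasSum f t := by
  have hsum := ENNReal.summable.hasSum_iff.2 h
  lift f to ι → NNReal using hf
  lift t to NNReal using ht
  simp only [ENNReal.ofReal_coe_nnreal] at hsum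
  exact_mod_cast hsum

theorem tsum_ofReal_eq_of_hasSum {f : ι → ℝ} {t : ℝ} (hf : ∀ i, 0 ≤ f i) (h : HasSum f t) :
    ∑' i, ENNReal.ofReal (f i) = ENNReal.ofReal t := by
  rw [← ENNReal.ofReal_tsum_of_nonneg hf h.summable, h.tsum_eq]

end Series

section Hilbert

variable {H : Type*} [NormedAddCommGroup H] [InnerProductSpace ℂ H] {ι κ : Type*}

section Basis

variable (b : HilbertBasis ι ℂ H)

theorem hasSum_inner_smul (ψ : H) : HasSum (fun i => ⟪b i, ψ⟫_ℂ • b i) ψ := by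
  simpa only [b.repr_apply_apply] using b.hasSum_repr ψ

theorem hasSum_norm_inner_sq (ψ : H) : HasSum (fun i => ‖⟪b i, ψ⟫_ℂ‖ ^ 2) (‖ψ‖ ^ 2) := by
  have hterm (i) : ⟪ψ, b i⟫_ℂ * ⟪b i, ψ⟫_ℂ = ((‖⟪b i, ψ⟫_ℂ‖ ^ 2 : ℝ) : ℂ) := by
    rw [← inner_conj_symm ψ (b i), Complex.conj_mul', Complex.ofReal_pow]
  have hnorm : ⟪ψ, ψ⟫_ℂ = ((‖ψ‖ ^ 2 : ℝ) : ℂ) := by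
    rw [inner_self_eq_norm_sq_to_K, Complex.ofReal_pow]
    rfl
  have h := b.hasSum_inner_mul_inner ψ ψ
  simp only [hterm, hnorm] at h
  exact Complex.hasSum_ofReal.1 h

theorem tsum_ofReal_norm_inner_sq (ψ : H) :
    ∑' i, ENNReal.ofReal (‖⟪b i, ψ⟫_ℂ‖ ^ 2) = ENNReal.ofReal (‖ψ‖ ^ 2) := by
  rw [← (hasSum_norm_inner_sq b ψ).tsum_eq,
    ENNReal.ofReal_tsum_of_nonneg (fun _ => sq_nonneg _) (hasSum_norm_inner_sq b ψ).summable]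

theorem ext_of_hilbertBasis {E : Type*} [NormedAddCommGroup E] [NormedSpace ℂ E]
    {T T' : H →L[ℂ] E} (h : ∀ i, T (b i) = T' (b i)) : T = T' := by
  refine ContinuousLinearMap.ext_on (s := Set.range b) ?_ (Set.forall_mem_range.2 h)
  rw [Submodule.dense_iff_topologicalClosure_eq_top]
  exact b.dense_span

theorem apply_eq_smul_of_inner_ne_zero {T : H →L[ℂ] H} {t : ι → ℂ}
    (hT : ∀ i, T (b i) = t i • b i) {ψ : H} {s : ℂ} (h : ∀ i, ⟪b i, ψ⟫_ℂ ≠ 0 → t i = s) :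
    T ψ = s • ψ := by
  refine ((hasSum_inner_smul b ψ).mapL T).unique ?_
  convert (hasSum_inner_smul b ψ).const_smul s using 2 with i
  rw [map_smul, hT]
  by_cases hi : ⟪b i, ψ⟫_ℂ = 0
  · simp only [hi, zero_smul, smul_zero]
  · rw [h i hi, smul_comm]

theorem reApplyInnerSelf_of_apply_eq_smul {T : H →L[ℂ] H} {t : ℝ} {i : ι}
    (h : T (b i) = (t : ℂ) • b i) : T.reApplyInnerSelf (b i) = t := by
  rw [T.reApplyInnerSelf_apply, h, inner_smul_left, inner_self_eq_norm_sq_to_K,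
    b.orthonormal.1 i]
  simp

variable [CompleteSpace H]

theorem exists_diagonal {c : ι → ℝ} (hc : Summable c) :
    ∃ T : H →L[ℂ] H, ∀ i, T (b i) = (c i : ℂ) • b i := by
  classical
  have hP : Summable fun j => (c j : ℂ) • InnerProductSpace.rankOne ℂ (b j) (b j) := by
    refine Summable.of_norm_bounded hc.norm fun j => ?_
    rw [norm_smul, InnerProductSpace.norm_rankOne, b.orthonormal.1 j, Complex.norm_real,
      mul_one, mul_one]
  refine ⟨_, fun i => (hP.hasSum.mapL (ContinuousLinearMap.apply ℂ H (b i))).unique ?_⟩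
  simp only [ContinuousLinearMap.apply_apply, smul_apply, InnerProductSpace.rankOne_apply,
    orthonormal_iff_ite.1 b.orthonormal]
  convert hasSum_single i fun j hj => ?_ using 1
  · simp
  · simp [hj]

theorem isSelfAdjoint_of_eigenbasis {T : H →L[ℂ] H} {t : ι → ℝ}
    (hT : ∀ i, T (b i) = (t i : ℂ) • b i) : IsSelfAdjoint T := by
  classical
  rw [ContinuousLinearMap.isSelfAdjoint_iff']
  refine ext_of_hilbertBasis b fun i => b.repr.injective (lp.ext (funext fun j => ?_))
  rw [b.repr_apply_apply, b.repr_apply_apply, ContinuousLinearMap.adjoint_inner_right, hT, hT,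
    inner_smul_left, inner_smul_right, orthonormal_iff_ite.1 b.orthonormal j i,
    Complex.conj_ofReal]
  split_ifs with h
  · rw [h]
  · rw [mul_zero, mul_zero]

theorem hasSum_mul_norm_inner_sq {T : H →L[ℂ] H} {t : ι → ℝ}
    (hT : ∀ i, T (b i) = (t i : ℂ) • b i) (ψ : H) :
    HasSum (fun i => t i * ‖⟪b i, ψ⟫_ℂ‖ ^ 2) (T.reApplyInnerSelf ψ) := by
  have hterm (i) : ⟪T ψ, b i⟫_ℂ * ⟪b i, ψ⟫_ℂ = ((t i * ‖⟪b i, ψ⟫_ℂ‖ ^ 2 : ℝ) : ℂ) := by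
    rw [(isSelfAdjoint_of_eigenbasis b hT).isSymmetric.apply_clm, hT, inner_smul_right,
      ← inner_conj_symm ψ (b i), mul_assoc, Complex.conj_mul', Complex.ofReal_mul,
      Complex.ofReal_pow]
  have h := b.hasSum_inner_mul_inner (T ψ) ψ
  simp only [hterm] at h
  exact Complex.hasSum_re h

theorem isPositive_of_eigenbasis {T : H →L[ℂ] H} {t : ι → ℝ} (ht : ∀ i, 0 ≤ t i)
    (hT : ∀ i, T (b i) = (t i : ℂ) • b i) : T.IsPositive :=
  ContinuousLinearMap.isPositive_def'.2 ⟨isSelfAdjoint_of_eigenbasis b hT, fun ψ =>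
    (hasSum_mul_norm_inner_sq b hT ψ).nonneg fun i => mul_nonneg (ht i) (sq_nonneg _)⟩

end Basis

theorem mem_spectrum_of_apply_eq_smul {T : H →L[ℂ] H} {v : H} (hv : v ≠ 0) {t : ℝ}
    (h : T v = (t : ℂ) • v) : t ∈ spectrum ℝ T := by
  rintro ⟨u, hu⟩
  have hker : (u : H →L[ℂ] H) v = 0 := by
    rw [hu, Algebra.algebraMap_eq_smul_one, sub_apply, h]
    exact sub_self _
  have hinv : ((u⁻¹ : (H →L[ℂ] H)ˣ) : H →L[ℂ] H) ((u : H →L[ℂ] H) v) = v :=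
    congrArg (fun S : H →L[ℂ] H => S v) u.inv_mul
  exact hv (by rw [← hinv, hker, map_zero])

theorem reApplyInnerSelf_nonneg {T : H →L[ℂ] H} (hT : T.IsPositive) (ψ : H) :
    0 ≤ T.reApplyInnerSelf ψ :=
  hT.re_inner_nonneg_left ψ

theorem reApplyInnerSelf_eq_norm_sq {T R : H →L[ℂ] H} (hR : ∀ φ ψ, ⟪φ, T ψ⟫_ℂ = ⟪R φ, R ψ⟫_ℂ)
    (ψ : H) : T.reApplyInnerSelf ψ = ‖R ψ‖ ^ 2 := by
  rw [T.reApplyInnerSelf_apply, inner_re_symm, hR, inner_self_eq_norm_sq]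

variable [CompleteSpace H]

theorem exists_isSelfAdjoint_inner_apply {T : H →L[ℂ] H} (hT : T.IsPositive) :
    ∃ R : H →L[ℂ] H, IsSelfAdjoint R ∧ ∀ φ ψ, ⟪φ, T ψ⟫_ℂ = ⟪R φ, R ψ⟫_ℂ := by
  obtain ⟨R, hR, rfl⟩ := CStarAlgebra.nonneg_iff_exists_isSelfAdjoint_and_eq_mul_self.1
    (T.nonneg_iff_isPositive.2 hT)
  exact ⟨R, hR, fun φ ψ => (hR.isSymmetric φ (R ψ)).symm⟩

theorem norm_inner_apply_sq_le {T : H →L[ℂ] H} (hT : T.IsPositive) (φ ψ : H) :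
    ‖⟪φ, T ψ⟫_ℂ‖ ^ 2 ≤ T.reApplyInnerSelf φ * T.reApplyInnerSelf ψ := by
  obtain ⟨R, -, hR⟩ := exists_isSelfAdjoint_inner_apply hT
  rw [hR, reApplyInnerSelf_eq_norm_sq hR, reApplyInnerSelf_eq_norm_sq hR, ← mul_pow]
  exact pow_le_pow_left₀ (norm_nonneg _) (norm_inner_le_norm _ _) 2

theorem tsum_ofReal_reApplyInnerSelf_eq {T : H →L[ℂ] H} (hT : T.IsPositive)
    (b : HilbertBasis ι ℂ H) (c : HilbertBasis κ ℂ H) :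
    ∑' i, ENNReal.ofReal (T.reApplyInnerSelf (b i)) =
      ∑' k, ENNReal.ofReal (T.reApplyInnerSelf (c k)) := by
  obtain ⟨R, hRsa, hR⟩ := exists_isSelfAdjoint_inner_apply hT
  have hswap (i k) : ‖⟪c k, R (b i)⟫_ℂ‖ = ‖⟪b i, R (c k)⟫_ℂ‖ := by
    rw [← hRsa.isSymmetric.apply_clm, norm_inner_symm]
  calc ∑' i, ENNReal.ofReal (T.reApplyInnerSelf (b i))
      = ∑' i, ∑' k, ENNReal.ofReal (‖⟪c k, R (b i)⟫_ℂ‖ ^ 2) := by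
        simp only [tsum_ofReal_norm_inner_sq, reApplyInnerSelf_eq_norm_sq hR]
    _ = ∑' k, ∑' i, ENNReal.ofReal (‖⟪b i, R (c k)⟫_ℂ‖ ^ 2) := by
        rw [ENNReal.tsum_comm]
        simp only [hswap]
    _ = ∑' k, ENNReal.ofReal (T.reApplyInnerSelf (c k)) := by
        simp only [tsum_ofReal_norm_inner_sq, reApplyInnerSelf_eq_norm_sq hR]

theorem hasSum_reApplyInnerSelf {T : H →L[ℂ] H} (hT : T.IsPositive) {b : HilbertBasis ι ℂ H}
    (c : HilbertBasis κ ℂ H) {t : ℝ} (h : HasSum (fun i => T.reApplyInnerSelf (b i)) t) :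
    HasSum (fun k => T.reApplyInnerSelf (c k)) t := by
  refine hasSum_of_tsum_ofReal_eq (fun k => reApplyInnerSelf_nonneg hT _)
    (h.nonneg fun i => reApplyInnerSelf_nonneg hT _) ?_
  rw [← tsum_ofReal_reApplyInnerSelf_eq hT b c,
    tsum_ofReal_eq_of_hasSum (fun i => reApplyInnerSelf_nonneg hT _) h]

theorem norm_le_of_hasSum_reApplyInnerSelf {T : H →L[ℂ] H} (hT : T.IsPositive)
    {b : HilbertBasis ι ℂ H} {t : ℝ} (h : HasSum (fun i => T.reApplyInnerSelf (b i)) t) :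
    ‖T‖ ≤ t := by
  have ht : 0 ≤ t := h.nonneg fun i => reApplyInnerSelf_nonneg hT _
  have hform (ψ : H) : T.reApplyInnerSelf ψ ≤ t * ‖ψ‖ ^ 2 := by
    obtain ⟨R, hRsa, hR⟩ := exists_isSelfAdjoint_inner_apply hT
    simp only [reApplyInnerSelf_eq_norm_sq hR] at h ⊢
    refine hasSum_le (fun i => ?_) (hasSum_norm_inner_sq b (R ψ)) (h.mul_right (‖ψ‖ ^ 2))
    rw [← hRsa.isSymmetric.apply_clm, ← mul_pow]
    exact pow_le_pow_left₀ (norm_nonneg _) (norm_inner_le_norm _ _) 2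
  refine T.opNorm_le_bound ht fun ψ => ?_
  have hcs := (norm_inner_apply_sq_le hT (T ψ) ψ).trans
    (mul_le_mul (hform _) (hform _) (reApplyInnerSelf_nonneg hT _) (by positivity))
  rw [inner_self_eq_norm_sq_to_K, norm_pow, RCLike.norm_ofReal, abs_norm] at hcs
  rcases (norm_nonneg (T ψ)).eq_or_lt with h0 | hpos
  · rw [← h0]
    positivity
  · refine le_of_sq_le_sq ?_ (by positivity)
    nlinarith [pow_pos hpos 2]

/-! ### Functional calculus and Klein's inequality -/

theorem cfcHom_apply_eq_smul {T : H →L[ℂ] H} (hT : IsSelfAdjoint T) {v : H} {t : ℝ}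
    (ht : t ∈ spectrum ℝ T) (h : T v = (t : ℂ) • v) (g : C(spectrum ℝ T, ℝ)) :
    cfcHom hT g v = (g ⟨t, ht⟩ : ℂ) • v := by
  have : CompactSpace (spectrum ℝ T) :=
    isCompact_iff_compactSpace.1 (ContinuousFunctionalCalculus.isCompact_spectrum T)
  have hid : cfcHom hT (.restrict (spectrum ℝ T) <| .id ℝ) v = (t : ℂ) • v := by
    rw [cfcHom_id hT, h]
  induction g using ContinuousMap.induction_on_of_compact with
  | const r =>
    have hr : ContinuousMap.const (spectrum ℝ T) r = algebraMap ℝ _ r := rfl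
    rw [hr, AlgHomClass.commutes, Algebra.algebraMap_eq_smul_one]
    simp
  | id => exact hid
  | star_id => simpa using hid
  | add f g hf hg => simp [hf, hg, add_smul]
  | mul f g hf hg =>
    rw [map_mul, mul_apply_eq_comp, hg, map_smul, hf, smul_smul, ContinuousMap.mul_apply,
      Complex.ofReal_mul, mul_comm]
  | frequently f hf =>
    have hclosed : IsClosed {g : C(spectrum ℝ T, ℝ) | cfcHom hT g v = (g ⟨t, ht⟩ : ℂ) • v} :=
      isClosed_eq
        ((ContinuousLinearMap.apply ℂ H v).continuous.comp (cfcHom_continuous hT))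
        ((Complex.continuous_ofReal.comp (continuous_eval_const _)).smul continuous_const)
    exact hclosed.mem_of_frequently_of_tendsto hf Filter.tendsto_id

theorem cfc_apply_eq_smul {T : H →L[ℂ] H} (hT : IsSelfAdjoint T) {v : H} (hv : v ≠ 0) {t : ℝ}
    (h : T v = (t : ℂ) • v) {f : ℝ → ℝ} (hf : Continuous f) :
    cfc (p := IsSelfAdjoint) f T v = (f t : ℂ) • v := by
  rw [cfc_apply f T hT hf.continuousOn,
    cfcHom_apply_eq_smul hT (mem_spectrum_of_apply_eq_smul hv h) h]
  rfl

theorem negMulLog_add_le {p q : ℝ} (hp : 0 ≤ p) (hq : 0 < q) :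
    Real.negMulLog p + p ≤ -Real.log q * p + q := by
  rcases hp.eq_or_lt with rfl | hp
  · simpa using hq.le
  · have hlog := Real.log_le_sub_one_of_pos (div_pos hq hp)
    rw [Real.log_div hq.ne' hp.ne'] at hlog
    have hmul : p * (q / p) = q := by field_simp
    rw [Real.negMulLog]
    nlinarith [mul_le_mul_of_nonneg_left hlog hp.le]

/- Sum `negMulLog_add_le` for the eigenvalues `p i` against the doubly stochastic weights
`|⟨b i, c k⟩|²`. -/
theorem tsum_negMulLog_le {T : H →L[ℂ] H} (b : HilbertBasis ι ℂ H) (c : HilbertBasis κ ℂ H)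
    {p : ι → ℝ} {q : κ → ℝ} (hT : ∀ i, T (b i) = (p i : ℂ) • b i) (hp0 : ∀ i, 0 ≤ p i)
    (hp : HasSum p 1) (hq0 : ∀ k, 0 < q k) (hq : HasSum q 1) :
    ∑' i, ENNReal.ofReal (Real.negMulLog (p i)) ≤
      ∑' k, ENNReal.ofReal (-Real.log (q k) * T.reApplyInnerSelf (c k)) := by
  have hp1 (i) : p i ≤ 1 := le_hasSum hp i fun _ _ => hp0 _
  have hlog (k) : 0 ≤ -Real.log (q k) := neg_nonneg.2
    (Real.log_nonpos (hq0 k).le (le_hasSum hq k fun _ _ => (hq0 _).le))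
  have hη (i) : 0 ≤ Real.negMulLog (p i) := Real.negMulLog_nonneg (hp0 i) (hp1 i)
  let w (i : ι) (k : κ) : ℝ≥0∞ := ENNReal.ofReal (‖⟪b i, c k⟫_ℂ‖ ^ 2)
  have hrow (i) : ∑' k, w i k = 1 := by
    simp only [w, norm_inner_symm (b i), tsum_ofReal_norm_inner_sq, b.orthonormal.1 i, one_pow,
      ENNReal.ofReal_one]
  have hcol (k) : ∑' i, w i k = 1 := by
    simp only [w, tsum_ofReal_norm_inner_sq, c.orthonormal.1 k, one_pow, ENNReal.ofReal_one]
  have hform (k) : ∑' i, ENNReal.ofReal (-Real.log (q k) * p i) * w i k =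
      ENNReal.ofReal (-Real.log (q k) * T.reApplyInnerSelf (c k)) := by
    simp only [w, ← ENNReal.ofReal_mul (mul_nonneg (hlog k) (hp0 _)), mul_assoc]
    exact tsum_ofReal_eq_of_hasSum (fun i => by have := hlog k; have := hp0 i; positivity)
      ((hasSum_mul_norm_inner_sq b hT (c k)).mul_left _)
  have hterm (i k) : ENNReal.ofReal (Real.negMulLog (p i)) * w i k + ENNReal.ofReal (p i) * w i k ≤
      ENNReal.ofReal (-Real.log (q k) * p i) * w i k + ENNReal.ofReal (q k) * w i k := by
    rw [← add_mul, ← add_mul, ← ENNReal.ofReal_add (hη i) (hp0 i),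
      ← ENNReal.ofReal_add (mul_nonneg (hlog k) (hp0 i)) (hq0 k).le]
    exact mul_le_mul_left (ENNReal.ofReal_le_ofReal (negMulLog_add_le (hp0 i) (hq0 k))) _
  have hsum := ENNReal.tsum_le_tsum fun i => ENNReal.tsum_le_tsum (hterm i)
  simp only [ENNReal.tsum_add] at hsum
  rw [ENNReal.tsum_comm (f := fun i k => ENNReal.ofReal (-Real.log (q k) * p i) * w i k),
    ENNReal.tsum_comm (f := fun i k => ENNReal.ofReal (q k) * w i k)] at hsum
  simp only [hform, ENNReal.tsum_mul_left, hrow, hcol, mul_one, tsum_ofReal_eq_of_hasSum hp0 hp,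
    tsum_ofReal_eq_of_hasSum (fun k => (hq0 k).le) hq] at hsum
  exact (ENNReal.add_le_add_iff_right ENNReal.ofReal_ne_top).1 hsum

end Hilbert

/-! ### Matrix entries, trace and entropy of operators on `ℓ²(κ)` -/

section Entries

variable {κ : Type}

/-- The standard basis `(δ_k)` of `ℓ²(κ)`. -/
def ket : HilbertBasis κ ℂ (L2 κ) := HilbertBasis.ofRepr (LinearIsometryEquiv.refl ℂ (L2 κ))

theorem inner_ket_left (k : κ) (ψ : L2 κ) : ⟪ket k, ψ⟫_ℂ = ψ k :=
  (ket.repr_apply_apply ψ k).symm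

theorem inner_ket_right (k : κ) (ψ : L2 κ) : ⟪ψ, ket k⟫_ℂ = conj (ψ k) := by
  rw [← inner_conj_symm, inner_ket_left]

open scoped Classical in
theorem ket_apply (k l : κ) : ket k l = if l = k then 1 else 0 := by
  rw [← inner_ket_left, orthonormal_iff_ite.1 ket.orthonormal]

/-- The matrix entry `⟨δ_k, T δ_l⟩` of an operator on `ℓ²(κ)`. -/
def entry (T : L2 κ →L[ℂ] L2 κ) (k l : κ) : ℂ := T (ket l) k

/-- The diagonal `⟨δ_k, T δ_k⟩` of a self-adjoint operator on `ℓ²(κ)`, as a real function. -/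
def diag (T : L2 κ →L[ℂ] L2 κ) (k : κ) : ℝ := T.reApplyInnerSelf (ket k)

theorem entry_eq_inner (T : L2 κ →L[ℂ] L2 κ) (k l : κ) : entry T k l = ⟪ket k, T (ket l)⟫_ℂ :=
  (inner_ket_left k _).symm

theorem re_entry_self (T : L2 κ →L[ℂ] L2 κ) (k : κ) : (entry T k k).re = diag T k := by
  rw [entry_eq_inner, diag, T.reApplyInnerSelf_apply, inner_re_symm]
  rfl

theorem ext_of_entry {T T' : L2 κ →L[ℂ] L2 κ} (h : ∀ k l, entry T k l = entry T' k l) : T = T' :=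
  ext_of_hilbertBasis ket fun l => lp.ext (funext fun k => h k l)

theorem hasSum_norm_apply_sq (ψ : L2 κ) : HasSum (fun k => ‖ψ k‖ ^ 2) (‖ψ‖ ^ 2) := by
  simpa only [inner_ket_left] using hasSum_norm_inner_sq ket ψ

theorem conj_entry {T : L2 κ →L[ℂ] L2 κ} (hT : IsSelfAdjoint T) (k l : κ) :
    conj (entry T k l) = entry T l k := by
  rw [entry_eq_inner, entry_eq_inner, inner_conj_symm, hT.isSymmetric.apply_clm]

theorem entry_self {T : L2 κ →L[ℂ] L2 κ} (hT : IsSelfAdjoint T) (k : κ) :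
    entry T k k = diag T k := by
  rw [← re_entry_self, Complex.conj_eq_iff_re.1 (conj_entry hT k k)]

theorem norm_entry_sq_le {T : L2 κ →L[ℂ] L2 κ} (hT : T.IsPositive) (k l : κ) :
    ‖entry T k l‖ ^ 2 ≤ diag T k * diag T l := by
  rw [entry_eq_inner]
  exact norm_inner_apply_sq_le hT _ _

variable {ι : Type*} (b : HilbertBasis ι ℂ (L2 κ))

theorem hasSum_mul_conj_of_eigenbasis {T : L2 κ →L[ℂ] L2 κ} {t : ι → ℂ}
    (hT : ∀ i, T (b i) = t i • b i) (k l : κ) :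
    HasSum (fun i => t i * (b i k * conj (b i l))) (entry T k l) := by
  have h := ((hasSum_inner_smul b (ket l)).mapL T).mapL (innerSL ℂ (ket k))
  simp only [innerSL_apply_apply, map_smul, inner_ket_left, inner_ket_right, hT,
    smul_eq_mul] at h
  exact h.congr_fun fun i => by ring

theorem posTrace_eq_tsum {T : L2 κ →L[ℂ] L2 κ} (hT : T.IsPositive) :
    posTrace T = ∑' i, ENNReal.ofReal (T.reApplyInnerSelf (b i)) := by
  rw [tsum_ofReal_reApplyInnerSelf_eq hT b ket]
  exact tsum_congr fun k => by rw [← diag, ← re_entry_self]; rfl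

theorem posTrace_eq_tsum_eigenvalue {T : L2 κ →L[ℂ] L2 κ} {t : ι → ℝ} (ht : ∀ i, 0 ≤ t i)
    (hT : ∀ i, T (b i) = (t i : ℂ) • b i) : posTrace T = ∑' i, ENNReal.ofReal (t i) := by
  rw [posTrace_eq_tsum b (isPositive_of_eigenbasis b ht hT)]
  simp only [reApplyInnerSelf_of_apply_eq_smul b (hT _)]

theorem entropy_eq_tsum {T : L2 κ →L[ℂ] L2 κ} {p : ι → ℝ} (h0 : ∀ i, 0 ≤ p i)
    (hp : HasSum p 1) (hT : ∀ i, T (b i) = (p i : ℂ) • b i) :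
    entropy T = ∑' i, ENNReal.ofReal (Real.negMulLog (p i)) :=
  posTrace_eq_tsum_eigenvalue b
    (fun i => Real.negMulLog_nonneg (h0 i) (le_hasSum hp i fun _ _ => h0 _))
    fun i => cfc_apply_eq_smul (isSelfAdjoint_of_eigenbasis b hT) (b.orthonormal.ne_zero i) (hT i)
      Real.continuous_negMulLog

end Entries

/-! ### Operators that respect a grading with finite fibres -/

section Graded

variable {κ γ : Type} {deg : κ → γ}

/-- An orthonormal basis of `ℓ²(κ)` is graded if its `i`-th vector is supported in the fibre of
`deg` through `i`. -/
def IsGradedBasis (deg : κ → γ) (b : HilbertBasis κ ℂ (L2 κ)) : Prop :=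
  ∀ ⦃i k⦄, deg k ≠ deg i → b i k = 0

/-- An operator on `ℓ²(κ)` conserves `deg` if its matrix is block diagonal with respect to the
fibres of `deg`. -/
def Conserves (deg : κ → γ) (T : L2 κ →L[ℂ] L2 κ) : Prop :=
  ∀ ⦃k l⦄, deg k ≠ deg l → entry T k l = 0

theorem conserves_of_graded_eigenbasis {b : HilbertBasis κ ℂ (L2 κ)} (hgr : IsGradedBasis deg b)
    {T : L2 κ →L[ℂ] L2 κ} {t : κ → ℂ} (hT : ∀ i, T (b i) = t i • b i) : Conserves deg T := by
  intro k l hkl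
  refine (hasSum_mul_conj_of_eigenbasis b hT k l).unique ?_
  convert hasSum_zero with i
  by_cases hk : deg k = deg i
  · have hl : deg l ≠ deg i := fun e => hkl (hk.trans e.symm)
    rw [hgr hl, map_zero, mul_zero, mul_zero]
  · rw [hgr hk, zero_mul, mul_zero]

theorem isGradedBasis_ket : IsGradedBasis deg ket := by
  classical
  intro i k h
  rw [ket_apply, if_neg fun e => h (congrArg deg e)]

/-- The inclusion of `ℓ²(κ)` into the functions on `κ`. -/
def toFunₗ : L2 κ →ₗ[ℂ] κ → ℂ where
  toFun ψ := ψ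
  map_add' _ _ := rfl
  map_smul' _ _ := rfl

section Fintype

variable [∀ N, Fintype {k // deg k = N}]

theorem hasSum_fiber {α : Type*} [AddCommMonoid α] [TopologicalSpace α] {f : κ → α} (N : γ)
    (hf : ∀ k, deg k ≠ N → f k = 0) : HasSum f (∑ k : {k // deg k = N}, f k) := by
  refine (Function.Injective.hasSum_iff Subtype.val_injective fun k hk => hf k fun h => ?_).1
    (hasSum_fintype _)
  exact hk ⟨⟨k, h⟩, rfl⟩

theorem hasSum_sum_fiber {f : κ → ℝ} {a : ℝ} (h : HasSum f a) :
    HasSum (fun N => ∑ k : {k // deg k = N}, f k) a :=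
  ((Equiv.sigmaFiberEquiv deg).hasSum_iff.2 h).sigma fun _ => hasSum_fintype _

theorem hasSum_of_hasSum_sum_fiber {f : κ → ℝ} (hf : ∀ k, 0 ≤ f k) {a : ℝ}
    (h : HasSum (fun N => ∑ k : {k // deg k = N}, f k) a) : HasSum f a := by
  have hs : Summable (f ∘ Equiv.sigmaFiberEquiv deg) :=
    (summable_sigma_of_nonneg fun _ => hf _).2
      ⟨fun _ => Summable.of_finite, h.summable.congr fun _ => (tsum_fintype _).symm⟩
  have hf' := ((Equiv.sigmaFiberEquiv deg).summable_iff.1 hs).hasSum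
  rwa [h.unique (hasSum_sum_fiber hf')]

theorem sum_fiber_inner_smul_apply {b : HilbertBasis κ ℂ (L2 κ)} (hgr : IsGradedBasis deg b) (N : γ)
    (ψ : L2 κ) {k : κ} (hk : deg k = N) :
    (∑ i : {i // deg i = N}, ⟪b i, ψ⟫_ℂ • b i : L2 κ) k = ψ k := by
  have h := (hasSum_inner_smul b ψ).mapL (innerSL ℂ (ket k))
  simp only [innerSL_apply_apply, inner_smul_right, inner_ket_left] at h
  rw [← inner_ket_left, inner_sum]
  simp only [inner_smul_right, inner_ket_left]
  refine (hasSum_fiber N fun i hi => ?_).unique h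
  rw [hgr fun e => hi (e.symm.trans hk), mul_zero]

theorem sum_fiber_inner_smul_apply_of_ne {b : HilbertBasis κ ℂ (L2 κ)} (hgr : IsGradedBasis deg b)
    {N : γ} (ψ : L2 κ) {k : κ} (hk : deg k ≠ N) :
    (∑ i : {i // deg i = N}, ⟪b i, ψ⟫_ℂ • b i : L2 κ) k = 0 := by
  rw [← inner_ket_left, inner_sum]
  refine Finset.sum_eq_zero fun i _ => ?_
  rw [inner_smul_right, inner_ket_left, hgr fun e => hk (e.trans i.2), mul_zero]

theorem eq_sum_fiber {b : HilbertBasis κ ℂ (L2 κ)} (hgr : IsGradedBasis deg b) {N : γ} {ψ : L2 κ}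
    (hψ : ∀ k, deg k ≠ N → ψ k = 0) : ψ = ∑ i : {i // deg i = N}, ⟪b i, ψ⟫_ℂ • b i := by
  refine lp.ext (funext fun k => ?_)
  by_cases hk : deg k = N
  · exact (sum_fiber_inner_smul_apply hgr N ψ hk).symm
  · rw [hψ k hk, sum_fiber_inner_smul_apply_of_ne hgr ψ hk]

/-- The vector of `ℓ²(κ)` with prescribed coefficients on one fibre and zero coefficients
elsewhere. -/
def fiberVec {N : γ} (v : EuclideanSpace ℂ {k // deg k = N}) : L2 κ := ∑ k, v k • ket (k : κ)

theorem inner_fiberVec {N : γ} (v : EuclideanSpace ℂ {k // deg k = N}) (ψ : L2 κ) :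
    ⟪fiberVec v, ψ⟫_ℂ = ⟪v, WithLp.toLp 2 fun k => ψ k⟫_ℂ := by
  simp only [fiberVec, sum_inner, inner_smul_left, inner_ket_left, PiLp.inner_apply,
    RCLike.inner_apply, mul_comm]

theorem fiberVec_apply {N : γ} (v : EuclideanSpace ℂ {k // deg k = N}) {k : κ} (h : deg k = N) :
    fiberVec v k = v ⟨k, h⟩ := by
  classical
  rw [← inner_ket_left, fiberVec, inner_sum]
  simp only [inner_smul_right, inner_ket_left, ket_apply, mul_ite, mul_one, mul_zero]
  rw [Finset.sum_eq_single ⟨k, h⟩ (fun l _ hl => if_neg fun e => hl (Subtype.ext e.symm))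
    (fun h' => absurd (Finset.mem_univ _) h'), if_pos rfl]

theorem fiberVec_apply_of_ne {N : γ} (v : EuclideanSpace ℂ {k // deg k = N}) {k : κ}
    (h : deg k ≠ N) : fiberVec v k = 0 := by
  classical
  rw [← inner_ket_left, fiberVec, inner_sum]
  refine Finset.sum_eq_zero fun l _ => ?_
  have hl : k ≠ l := fun e => h (e ▸ l.2)
  rw [inner_smul_right, inner_ket_left, ket_apply, if_neg hl, mul_zero]

section FiberBases

variable (u : ∀ N, OrthonormalBasis {k // deg k = N} ℂ (EuclideanSpace ℂ {k // deg k = N}))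

theorem fiberVec_basis_eq {i : κ} {N : γ} (h : deg i = N) :
    fiberVec (u (deg i) ⟨i, rfl⟩) = fiberVec (u N ⟨i, h⟩) := by
  subst h
  rfl

theorem orthonormal_fiberVec : Orthonormal ℂ fun i => fiberVec (u (deg i) ⟨i, rfl⟩) := by
  classical
  rw [orthonormal_iff_ite]
  intro i j
  rw [inner_fiberVec]
  by_cases h : deg j = deg i
  · have hj : (WithLp.toLp 2 fun k : {k // deg k = deg i} => fiberVec (u (deg j) ⟨j, rfl⟩) k) =
        u (deg i) ⟨j, h⟩ := by
      ext k
      rw [fiberVec_basis_eq u h]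
      exact fiberVec_apply _ k.2
    rw [hj, orthonormal_iff_ite.1 (u _).orthonormal]
    simp only [Subtype.mk.injEq]
  · have hj : (WithLp.toLp 2 fun k : {k // deg k = deg i} => fiberVec (u (deg j) ⟨j, rfl⟩) k) =
        0 := by
      ext k
      exact fiberVec_apply_of_ne _ fun e => h (e.symm.trans k.2)
    have hne : i ≠ j := fun e => h (congrArg deg e.symm)
    rw [hj, inner_zero_right, if_neg hne]

theorem span_fiberVec_orthogonal :
    (Submodule.span ℂ (Set.range fun i => fiberVec (u (deg i) ⟨i, rfl⟩)))ᗮ = ⊥ := by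
  refine (Submodule.eq_bot_iff _).2 fun ψ hψ => lp.ext (funext fun k => ?_)
  have hzero : (WithLp.toLp 2 fun l : {l // deg l = deg k} => ψ l) = 0 := by
    refine (u (deg k)).repr.injective (PiLp.ext fun a => ?_)
    rw [OrthonormalBasis.repr_apply_apply, ← inner_fiberVec, map_zero]
    have ha := (Submodule.mem_orthogonal _ _).1 hψ _ (Submodule.subset_span ⟨a.1, rfl⟩)
    exact (congrArg (⟪·, ψ⟫_ℂ) (fiberVec_basis_eq u a.2)).symm.trans ha
  exact congrFun (congrArg WithLp.ofLp hzero) ⟨k, rfl⟩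

theorem exists_isGradedBasis_of_fiber_basis :
    ∃ b : HilbertBasis κ ℂ (L2 κ), IsGradedBasis deg b ∧
      ∀ i k (h : deg k = deg i), b i k = u (deg i) ⟨i, rfl⟩ ⟨k, h⟩ := by
  refine ⟨HilbertBasis.mkOfOrthogonalEqBot (orthonormal_fiberVec u) (span_fiberVec_orthogonal u),
    fun i k h => ?_, fun i k h => ?_⟩
  · rw [HilbertBasis.coe_mkOfOrthogonalEqBot]
    exact fiberVec_apply_of_ne _ h
  · rw [HilbertBasis.coe_mkOfOrthogonalEqBot]
    exact fiberVec_apply _ h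

end FiberBases

/- Both sides are the trace of `H T` over the fibre of `N`. -/
theorem sum_fiber_eigenvalue_mul {H : L2 κ →ₗ[ℂ] κ → ℂ} {b : HilbertBasis κ ℂ (L2 κ)} {ε : κ → ℝ}
    (hgr : IsGradedBasis deg b) (hH : ∀ i, H (b i) = (ε i : ℂ) • b i) {T : L2 κ →L[ℂ] L2 κ}
    (hT : Conserves deg T) (N : γ) :
    ∑ i : {i // deg i = N}, ε i * T.reApplyInnerSelf (b i) =
      ∑ k : {k // deg k = N}, (H (T (ket k)) k).re := by
  have hHT (k : {k // deg k = N}) :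
      H (T (ket k)) k = ∑ i : {i // deg i = N}, ⟪b i, T (ket k)⟫_ℂ * (ε i * b i k) := by
    conv_lhs => rw [eq_sum_fiber hgr (ψ := T (ket k)) fun l hl => hT fun e => hl (e.trans k.2)]
    simp only [map_sum, Finset.sum_apply, map_smul, hH, Pi.smul_apply, smul_eq_mul]
  have hTb (i : {i // deg i = N}) :
      ⟪b i, T (b i)⟫_ℂ = ∑ k : {k // deg k = N}, b i k * ⟪b i, T (ket k)⟫_ℂ := by
    have hket := eq_sum_fiber isGradedBasis_ket fun k hk => hgr fun e => hk (e.trans i.2)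
    refine (congrArg (fun ψ => ⟪b i, T ψ⟫_ℂ) hket).trans ?_
    simp only [map_sum, map_smul, inner_sum, inner_smul_right, inner_ket_left]
  have hre (i : {i // deg i = N}) :
      ε i * T.reApplyInnerSelf (b i) = (ε i * ⟪b i, T (b i)⟫_ℂ).re := by
    rw [Complex.re_ofReal_mul, ContinuousLinearMap.reApplyInnerSelf_apply, ← inner_re_symm]
    rfl
  simp only [hre, ← Complex.re_sum, hHT, hTb, Finset.mul_sum]
  rw [Finset.sum_comm]
  exact congrArg Complex.re
    (Finset.sum_congr rfl fun k _ => Finset.sum_congr rfl fun i _ => by ring)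

theorem sum_fiber_reApplyInnerSelf {b : HilbertBasis κ ℂ (L2 κ)} (hgr : IsGradedBasis deg b)
    {T : L2 κ →L[ℂ] L2 κ} (hT : Conserves deg T) (N : γ) :
    ∑ i : {i // deg i = N}, T.reApplyInnerSelf (b i) = ∑ k : {k // deg k = N}, diag T k := by
  have h := sum_fiber_eigenvalue_mul (H := toFunₗ) (ε := 1) hgr
    (fun i => (one_smul ℂ (b i : κ → ℂ)).symm) hT N
  simp only [Pi.one_apply, one_mul] at h
  exact h.trans (Finset.sum_congr rfl fun k _ => re_entry_self T k)

end Fintype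

theorem eigenvalue_eq_of_inner_ne_zero [∀ N, Finite {k // deg k = N}] {H : L2 κ →ₗ[ℂ] κ → ℂ}
    {b : HilbertBasis κ ℂ (L2 κ)} {ε : κ → ℝ} (hgr : IsGradedBasis deg b)
    (hH : ∀ i, H (b i) = (ε i : ℂ) • b i)
    (hloc : ∀ φ ψ : L2 κ, ∀ k, (∀ l, deg l = deg k → φ l = ψ l) → H φ k = H ψ k)
    {ψ : L2 κ} {e : ℝ} (hψ : H ψ = (e : ℂ) • ψ) {i : κ} (hi : ⟪b i, ψ⟫_ℂ ≠ 0) : ε i = e := by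
  have (N : γ) := Fintype.ofFinite {k // deg k = N}
  set φ : L2 κ := ∑ j : {j // deg j = deg i}, ⟪b j, ψ⟫_ℂ • b j with hφ_def
  have hφ {k : κ} (hk : deg k = deg i) : φ k = ψ k := sum_fiber_inner_smul_apply hgr _ ψ hk
  have hφ0 {k : κ} (hk : deg k ≠ deg i) : φ k = 0 := sum_fiber_inner_smul_apply_of_ne hgr ψ hk
  have hHφ : H φ = (e : ℂ) • φ := by
    funext k
    by_cases hk : deg k = deg i
    · rw [hloc φ ψ k fun l hl => hφ (hl.trans hk), hψ, Pi.smul_apply, Pi.smul_apply, hφ hk]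
    · rw [hloc φ 0 k fun l hl => hφ0 (hl.trans_ne hk), map_zero, Pi.smul_apply, hφ0 hk, smul_zero,
        Pi.zero_apply]
  have hsum : ∑ j : {j // deg j = deg i}, ((ε j - e) * ⟪b j, ψ⟫_ℂ) • b j = 0 := by
    refine lp.ext (Eq.trans ?_ (sub_eq_zero.2 hHφ))
    simp only [hφ_def, map_sum, map_smul, hH, sub_mul, sub_smul, Finset.sum_sub_distrib,
      Finset.smul_sum, smul_smul, lp.coeFn_sub, lp.coeFn_sum, lp.coeFn_smul, mul_comm]
  have hzero := (Fintype.linearIndependent_iff.1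
    (b.orthonormal.linearIndependent.comp _ Subtype.val_injective)) _ hsum ⟨i, rfl⟩
  exact Complex.ofReal_injective (sub_eq_zero.1 ((mul_eq_zero.1 hzero).resolve_right hi))

theorem exists_graded_eigenbasis [∀ N, Finite {k // deg k = N}] {H : L2 κ →ₗ[ℂ] κ → ℂ}
    (hdeg : ∀ ⦃k l⦄, deg k ≠ deg l → H (ket l) k = 0)
    (hsymm : ∀ k l, conj (H (ket l) k) = H (ket k) l) :
    ∃ (b : HilbertBasis κ ℂ (L2 κ)) (ε : κ → ℝ), IsGradedBasis deg b ∧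
      ∀ i, H (b i) = (ε i : ℂ) • b i := by
  classical
  have (N : γ) := Fintype.ofFinite {k // deg k = N}
  let M (N : γ) : Matrix {k // deg k = N} {k // deg k = N} ℂ := Matrix.of fun k l => H (ket l) k
  have hM (N) : (M N).IsHermitian := by
    ext k l
    exact hsymm l k
  obtain ⟨b, hgr, hb⟩ := exists_isGradedBasis_of_fiber_basis fun N => (hM N).eigenvectorBasis
  refine ⟨b, fun i => (hM (deg i)).eigenvalues ⟨i, rfl⟩, hgr, fun i => funext fun k => ?_⟩
  have hH : H (b i) k = ∑ l : {l // deg l = deg i}, b i l * H (ket l) k := by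
    conv_lhs => rw [eq_sum_fiber isGradedBasis_ket fun k hk => hgr hk]
    simp only [map_sum, Finset.sum_apply, map_smul, Pi.smul_apply, smul_eq_mul, inner_ket_left]
  rw [hH, Pi.smul_apply]
  by_cases hk : deg k = deg i
  · have heig := congrFun ((hM (deg i)).mulVec_eigenvectorBasis ⟨i, rfl⟩) ⟨k, hk⟩
    rw [Pi.smul_apply, Complex.real_smul, ← hb i k hk] at heig
    refine Eq.trans (Finset.sum_congr rfl fun l _ => ?_) heig
    rw [hb i l l.2, mul_comm]
    rfl
  · rw [hgr hk, smul_zero]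
    refine Finset.sum_eq_zero fun l _ => ?_
    rw [hdeg fun e => hk (e.trans l.2), mul_zero]

theorem exists_graded_eigenbasis_of_isSelfAdjoint [∀ N, Finite {k // deg k = N}]
    {T : L2 κ →L[ℂ] L2 κ} (hT : IsSelfAdjoint T) (hdeg : Conserves deg T) :
    ∃ b : HilbertBasis κ ℂ (L2 κ), IsGradedBasis deg b ∧
      ∀ i, T (b i) = (T.reApplyInnerSelf (b i) : ℂ) • b i := by
  obtain ⟨b, t, hgr, hb⟩ := exists_graded_eigenbasis (H := toFunₗ ∘ₗ T.toLinearMap) hdeg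
    fun k l => conj_entry hT k l
  have heig (i) : T (b i) = (t i : ℂ) • b i := lp.ext (hb i)
  refine ⟨b, hgr, fun i => ?_⟩
  rw [reApplyInnerSelf_of_apply_eq_smul b (heig i), heig]

end Graded

/-! ### Configurations and the particle number -/

section Configurations

theorem hasSum_prod_pi {ι : Type*} {f : ι → ℝ} (hf0 : ∀ n, 0 ≤ f n) {a : ℝ} (hf : HasSum f a)
    (S : Type*) [Fintype S] :
    HasSum (fun k : S → ι => ∏ x, f (k x)) (a ^ Fintype.card S) := by
  refine Fintype.induction_empty_option
    (P := fun S _ => HasSum (fun k : S → ι => ∏ x, f (k x)) (a ^ Fintype.card S)) ?_ ?_ ?_ S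
  · intro α β _ e ih
    let _ : Fintype α := Fintype.ofEquiv β e.symm
    rw [← Fintype.card_congr e, ← (e.arrowCongr (Equiv.refl ι)).hasSum_iff]
    exact ih.congr_fun fun k => Equiv.prod_comp e.symm fun x => f (k x)
  · simp only [Finset.univ_eq_empty, Finset.prod_empty, Fintype.card_eq_zero, pow_zero]
    exact hasSum_unique _
  · intro α _ ih
    rw [Fintype.card_option, pow_succ',
      ← (Equiv.piOptionEquivProd (β := fun _ => ι)).symm.hasSum_iff]
    have hs : Summable fun p : ι × (α → ι) => f p.1 * ∏ x, f (p.2 x) :=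
      hf.summable.mul_of_nonneg ih.summable hf0 fun k => Finset.prod_nonneg fun x _ => hf0 _
    exact (hf.mul ih hs).congr_fun fun p => Fintype.prod_option _

variable {S : Type} [Fintype S]

/-- The total number of particles of a configuration. -/
def deg (k : S → ℕ) : ℕ := ∑ x, k x

theorem le_deg (k : S → ℕ) (x : S) : k x ≤ deg k :=
  Finset.single_le_sum (f := k) (fun _ _ => Nat.zero_le _) (Finset.mem_univ x)

instance fintypeFiberDeg (N : ℕ) : Fintype {k : S → ℕ // deg k = N} :=
  have : Finite {k : S → ℕ // deg k = N} :=
    (Set.Finite.pi' fun _ : S => Set.finite_Iic N).subset fun k hk x => (le_deg k x).trans_eq hk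
  Fintype.ofFinite _

theorem hasSum_half_pow_deg :
    HasSum (fun k : S → ℕ => (1 / 2 : ℝ) ^ (deg k + Fintype.card S)) 1 := by
  have h : HasSum (fun n : ℕ => (1 / 2 : ℝ) ^ (n + 1)) 1 := by
    simpa only [pow_succ, one_div, mul_comm, inv_pow, div_eq_mul_inv, one_mul] using
      hasSum_geometric_two' (1 : ℝ)
  have hpi := hasSum_prod_pi (fun n => by positivity) h S
  rw [one_pow] at hpi
  refine hpi.congr_fun fun k => ?_
  rw [Finset.prod_pow_eq_pow_sum, Finset.sum_add_distrib, Finset.sum_const, smul_eq_mul, mul_one]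
  rfl

theorem deg_add_single [DecidableEq S] (k : S → ℕ) (x : S) :
    deg (k + Pi.single x 1) = deg k + 1 := by
  simp only [deg, Pi.add_apply, Finset.sum_add_distrib, Finset.sum_pi_single', Finset.mem_univ,
    if_true]

end Configurations

/-! ### Hopping -/

section Hopping

variable {S : Type}

/-- The coefficient `√nₓ √(n_y + 1)` of `a†ₓ a_y` at the configuration `k`, for `x ≠ y`. -/
def hopCoef (x y : S) (k : S → ℕ) : ℝ := √(k x) * √(k y + 1)

theorem hopCoef_eq_zero {x y : S} {k : S → ℕ} (h : k x = 0) : hopCoef x y k = 0 := by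
  rw [hopCoef, h, Nat.cast_zero, Real.sqrt_zero, zero_mul]

variable [DecidableEq S]

/-- The configuration with one particle moved from `x` to `y`; meaningful only if `k x ≠ 0`, the
subtraction being truncated. -/
def hop (x y : S) (k : S → ℕ) : S → ℕ := k - Pi.single x 1 + Pi.single y 1

theorem hop_add_single (x y : S) (n : S → ℕ) :
    hop x y (n + Pi.single x 1) = n + Pi.single y 1 := by
  rw [hop, add_tsub_cancel_right]

theorem hopCoef_add_single {x y : S} (hxy : x ≠ y) (n : S → ℕ) :
    hopCoef x y (n + Pi.single x 1) = √(n x + 1) * √(n y + 1) := by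
  simp [hopCoef, hxy.symm]

theorem exists_eq_add_single {x : S} {k : S → ℕ} (h : k x ≠ 0) :
    ∃ n : S → ℕ, k = n + Pi.single x 1 := by
  refine ⟨k - Pi.single x 1, (tsub_add_cancel_of_le ?_).symm⟩
  exact update_le_iff.2 ⟨Nat.one_le_iff_ne_zero.2 h, fun _ _ => Nat.zero_le _⟩

theorem hasSum_add_single_iff {E : Type*} [AddCommMonoid E] [TopologicalSpace E]
    {g : (S → ℕ) → E} {x : S} (hg : ∀ k, k x = 0 → g k = 0) {a : E} :
    HasSum (fun n : S → ℕ => g (n + Pi.single x 1)) a ↔ HasSum g a := by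
  refine (add_left_injective (Pi.single x 1)).hasSum_iff (f := g) fun k hk => hg k ?_
  by_contra h0
  obtain ⟨n, rfl⟩ := exists_eq_add_single h0
  exact hk ⟨n, rfl⟩

theorem creat_mul_annih_apply {x y : S} (hxy : x ≠ y) (ψ : (S → ℕ) → ℂ) (k : S → ℕ) :
    (creat x * annih y) ψ k = hopCoef x y k * ψ (hop x y k) := by
  simp [creat, annih, hopCoef, hop, hxy.symm, mul_assoc]

theorem num_apply (x : S) (ψ : (S → ℕ) → ℂ) (k : S → ℕ) : num x ψ k = k x * ψ k := by
  by_cases h : k x = 0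
  · simp [num, creat, h]
  · obtain ⟨n, rfl⟩ := exists_eq_add_single h
    have hsqrt : (√((n x : ℝ) + 1) : ℂ) * (√((n x : ℝ) + 1) : ℂ) = (n x : ℂ) + 1 := by
      rw [← Complex.ofReal_mul, Real.mul_self_sqrt (by positivity)]
      push_cast
      rfl
    simp [num, creat, annih, ← mul_assoc, hsqrt]

theorem hop_symm {x y : S} (hxy : x ≠ y) {k : S → ℕ} (hk : k x ≠ 0) :
    hop x y k y ≠ 0 ∧ hop y x (hop x y k) = k ∧ hopCoef y x (hop x y k) = hopCoef x y k := by
  obtain ⟨n, rfl⟩ := exists_eq_add_single hk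
  rw [hop_add_single]
  refine ⟨by simp, hop_add_single y x n, ?_⟩
  rw [hopCoef_add_single hxy, hopCoef_add_single hxy.symm, mul_comm]

theorem hopCoef_mul_ket_symm {x y : S} (hxy : x ≠ y) (k l : S → ℕ) :
    (hopCoef x y k * ket l (hop x y k) : ℂ) = hopCoef y x l * ket k (hop y x l) := by
  classical
  have key {x y : S} (hxy : x ≠ y) {k l : S → ℕ} (h : hopCoef x y k * ket l (hop x y k) ≠ (0 : ℂ)) :
      (hopCoef x y k * ket l (hop x y k) : ℂ) = hopCoef y x l * ket k (hop y x l) := by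
    have hk : k x ≠ 0 := fun hk => h (by rw [hopCoef_eq_zero hk, Complex.ofReal_zero, zero_mul])
    have hl : hop x y k = l := by
      by_contra hne
      exact h (by rw [ket_apply, if_neg hne, mul_zero])
    obtain ⟨-, hhop, hcoef⟩ := hop_symm hxy hk
    rw [hl] at hhop hcoef
    rw [hl, hhop, hcoef, ket_apply, ket_apply, if_pos rfl, if_pos rfl]
  by_cases h : hopCoef x y k * ket l (hop x y k) = (0 : ℂ)
  · by_contra hne
    exact hne (key hxy.symm fun h' => hne (h.trans h'.symm)).symm
  · exact key hxy h

theorem deg_hop [Fintype S] (x y : S) {k : S → ℕ} (hk : k x ≠ 0) : deg (hop x y k) = deg k := by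
  obtain ⟨n, rfl⟩ := exists_eq_add_single hk
  rw [hop_add_single, deg_add_single, deg_add_single]

end Hopping

/-! ### The Hamiltonian in the occupation number basis -/

section Hamiltonian

variable {S : Type} [Fintype S] (G : SimpleGraph S)

theorem sum_adj_eq_sum_dart [DecidableRel G.Adj] {M : Type*} [AddCommMonoid M] (f : S → S → M) :
    (∑ x, ∑ y, if G.Adj x y then f x y else 0) = ∑ d : G.Dart, f d.fst d.snd := by
  rw [← Fintype.sum_prod_type' fun x y => if G.Adj x y then f x y else 0, ← Finset.sum_filter]
  exact (Finset.sum_bij (fun d _ => d.toProd) (fun d _ => by simp [d.adj])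
    (fun _ _ _ _ h => SimpleGraph.Dart.ext _ _ h)
    (fun p hp => ⟨⟨p, (Finset.mem_filter.1 hp).2⟩, Finset.mem_univ _, rfl⟩) fun _ _ => rfl).symm

theorem sum_dart_fst [DecidableRel G.Adj] (m : S → ℝ) :
    ∑ d : G.Dart, m d.fst = ∑ x, G.degree x * m x := by
  rw [← sum_adj_eq_sum_dart G fun x _ => m x]
  refine Finset.sum_congr rfl fun x _ => ?_
  rw [← Finset.sum_filter, Finset.sum_const, nsmul_eq_mul, ← G.neighborFinset_eq_filter,
    G.card_neighborFinset_eq_degree]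

theorem sum_dart_snd [DecidableRel G.Adj] (m : S → ℝ) :
    ∑ d : G.Dart, m d.snd = ∑ d : G.Dart, m d.fst :=
  Equiv.sum_comp SimpleGraph.Dart.symm_involutive.toPerm fun d : G.Dart => m d.fst

/-- The diagonal part `∑ₓ (U/2) nₓ(nₓ - 1) - μ nₓ` of the Hamiltonian. -/
def diagEnergy (U μ : ℝ) (k : S → ℕ) : ℝ := ∑ x, (U / 2 * (k x * (k x - 1)) - μ * k x)

variable [DecidableEq S] (J U μ : ℝ)

theorem hamiltonianExpr_apply [DecidableRel G.Adj] (ψ : (S → ℕ) → ℂ) (k : S → ℕ) :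
    hamiltonianExpr G J U μ ψ k =
      -J * ∑ d : G.Dart, (hopCoef d.fst d.snd k : ℂ) * ψ (hop d.fst d.snd k)
        + diagEnergy U μ k * ψ k := by
  have hhop (d : G.Dart) := creat_mul_annih_apply d.adj.ne ψ k
  have hsq (x : S) : (num x * (num x - 1)) ψ k = (k x * (k x - 1) : ℂ) * ψ k := by
    rw [Module.End.mul_apply, num_apply, LinearMap.sub_apply, Pi.sub_apply, num_apply,
      Module.End.one_apply]
    ring
  have hsum : (∑ x, ∑ y, if G.Adj x y then creat x * annih y else 0 :
      Module.End ℂ ((S → ℕ) → ℂ)) = ∑ d : G.Dart, creat d.fst * annih d.snd :=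
    sum_adj_eq_sum_dart G fun x y => creat x * annih y
  have hexpr : hamiltonianExpr G J U μ = (-J : ℂ) • ∑ d : G.Dart, creat d.fst * annih d.snd +
      (U / 2 : ℂ) • (∑ x, num x * (num x - 1)) - (μ : ℂ) • ∑ x, num x := by
    rw [← hsum, hamiltonianExpr]
    congr!
  simp only [hexpr, LinearMap.sub_apply, LinearMap.add_apply, LinearMap.smul_apply,
    Pi.sub_apply, Pi.add_apply, Pi.smul_apply, smul_eq_mul, LinearMap.sum_apply, Finset.sum_apply,
    hhop, hsq, num_apply, diagEnergy]
  push_cast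
  rw [Finset.sum_sub_distrib, ← Finset.mul_sum, ← Finset.mul_sum, ← Finset.sum_mul,
    ← Finset.sum_mul]
  ring

theorem hamiltonianExpr_apply_congr {φ ψ : (S → ℕ) → ℂ} {k : S → ℕ}
    (h : ∀ l, deg l = deg k → φ l = ψ l) :
    hamiltonianExpr G J U μ φ k = hamiltonianExpr G J U μ ψ k := by
  classical
  have hhop (d : G.Dart) : (hopCoef d.fst d.snd k : ℂ) * φ (hop d.fst d.snd k) =
      hopCoef d.fst d.snd k * ψ (hop d.fst d.snd k) := by
    by_cases hk : k d.fst = 0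
    · rw [hopCoef_eq_zero hk, Complex.ofReal_zero, zero_mul, zero_mul]
    · rw [h _ (deg_hop _ _ hk)]
  rw [hamiltonianExpr_apply, hamiltonianExpr_apply, h k rfl]
  simp only [hhop]

theorem hamiltonianExpr_ket_eq_zero {k l : S → ℕ} (h : deg k ≠ deg l) :
    hamiltonianExpr G J U μ (ket l) k = 0 := by
  rw [hamiltonianExpr_apply_congr G J U μ (ψ := 0) fun m hm =>
    isGradedBasis_ket (hm.trans_ne h), map_zero, Pi.zero_apply]

theorem conj_hamiltonianExpr_ket (k l : S → ℕ) :
    conj (hamiltonianExpr G J U μ (ket l) k) = hamiltonianExpr G J U μ (ket k) l := by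
  classical
  have hconj (k l : S → ℕ) : conj (ket l k : ℂ) = ket l k := by
    rw [ket_apply, apply_ite conj, map_one, map_zero]
  have hhop (d : G.Dart) : (hopCoef d.fst d.snd k : ℂ) * ket l (hop d.fst d.snd k) =
      hopCoef d.snd d.fst l * ket k (hop d.snd d.fst l) := hopCoef_mul_ket_symm d.adj.ne k l
  have hdiag : (diagEnergy U μ k : ℂ) * ket l k = diagEnergy U μ l * ket k l := by
    rw [ket_apply, ket_apply]
    by_cases h : k = l
    · rw [h]
    · rw [if_neg h, if_neg (Ne.symm h), mul_zero, mul_zero]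
  simp only [hamiltonianExpr_apply, map_add, map_mul, map_neg, map_sum, Complex.conj_ofReal, hconj]
  simp only [hhop, hdiag]
  congr 2
  exact Equiv.sum_comp SimpleGraph.Dart.symm_involutive.toPerm fun d : G.Dart =>
    (hopCoef d.fst d.snd l : ℂ) * ket k (hop d.fst d.snd l)

/-- An eigenbasis of the Hamiltonian, with energies `ε`, whose vectors have a definite particle
number. -/
structure IsEnergyBasis (b : HilbertBasis (S → ℕ) ℂ (Fock S)) (ε : (S → ℕ) → ℝ) : Prop where
  graded : IsGradedBasis deg b
  apply : ∀ i, hamiltonianExpr G J U μ (b i) = (ε i : ℂ) • b i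

theorem exists_isEnergyBasis : ∃ b ε, IsEnergyBasis G J U μ b ε := by
  obtain ⟨b, ε, hgr, hb⟩ := exists_graded_eigenbasis (H := hamiltonianExpr G J U μ ∘ₗ toFunₗ)
    (fun _ _ h => hamiltonianExpr_ket_eq_zero G J U μ h)
    fun k l => conj_hamiltonianExpr_ket G J U μ k l
  exact ⟨b, ε, hgr, hb⟩

namespace IsEnergyBasis

variable {G J U μ} {b : HilbertBasis (S → ℕ) ℂ (Fock S)} {ε : (S → ℕ) → ℝ}
  (hb : IsEnergyBasis G J U μ b ε)
include hb

theorem eq_of_inner_ne_zero {ψ : Fock S} {e : ℝ}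
    (hψ : hamiltonianExpr G J U μ ψ = (e : ℂ) • ψ) {i : S → ℕ} (hi : ⟪b i, ψ⟫_ℂ ≠ 0) : ε i = e :=
  eigenvalue_eq_of_inner_ne_zero (H := hamiltonianExpr G J U μ ∘ₗ toFunₗ) hb.graded hb.apply
    (fun _ _ _ h => hamiltonianExpr_apply_congr G J U μ h) hψ hi

theorem isHeatOperator_iff {β : ℝ} {T : Fock S →L[ℂ] Fock S} :
    IsHeatOperator (hamiltonian G J U μ) β T ↔
      ∀ i, T (b i) = (Real.exp (-β * ε i) : ℂ) • b i := by
  refine ⟨fun ⟨ι, c, e, hc⟩ i => ?_, fun hT => ⟨_, b, ε, fun i => ⟨?_, hT i⟩⟩⟩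
  · refine apply_eq_smul_of_inner_ne_zero c (fun j => (hc j).2) fun j hj => ?_
    obtain ⟨⟨_, hHc⟩, -⟩ := hc j
    rw [hb.eq_of_inner_ne_zero (congrArg (toFunₗ ·) hHc) (inner_eq_zero_symm.not.1 hj)]
  · have hmem : b i ∈ (hamiltonian G J U μ).domain := by
      change Memℓp (hamiltonianExpr G J U μ (b i)) 2
      rw [hb.apply i]
      exact lp.memℓp ((ε i : ℂ) • b i)
    exact ⟨hmem, lp.ext (hb.apply i)⟩

end IsEnergyBasis

end Hamiltonian

/-! ### States with a finite particle number variance -/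

section States

variable {S : Type}

/-- The mean occupation number of the site `x`. -/
def occMean (ρ : Fock S →L[ℂ] Fock S) (x : S) : ℝ := ∑' k, k x * diag ρ k

/-- The second moment of the occupation number of the site `x`. -/
def occSqMean (ρ : Fock S →L[ℂ] Fock S) (x : S) : ℝ := ∑' k, (k x : ℝ) ^ 2 * diag ρ k

variable [Fintype S]

/-- A density matrix that commutes with the particle number and in which the particle number has a
finite second moment. All states that occur in the argument are of this form. -/
structure IsState (ρ : Fock S →L[ℂ] Fock S) : Prop where
  isPositive : ρ.IsPositive
  hasSum_diag : HasSum (diag ρ) 1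
  conserves : Conserves deg ρ
  summable_deg_sq : Summable fun k : S → ℕ => (deg k : ℝ) ^ 2 * diag ρ k

theorem isState_of_graded_eigenbasis {b : HilbertBasis (S → ℕ) ℂ (Fock S)}
    {p : (S → ℕ) → ℝ} {ρ : Fock S →L[ℂ] Fock S} (hgr : IsGradedBasis deg b)
    (hρ : ∀ i, ρ (b i) = (p i : ℂ) • b i) (hp0 : ∀ i, 0 ≤ p i) (hp : HasSum p 1)
    (hsq : Summable fun i => (deg i : ℝ) ^ 2 * p i) : IsState ρ := by
  have hpos := isPositive_of_eigenbasis b hp0 hρ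
  have hcons := conserves_of_graded_eigenbasis hgr hρ
  have hr (i) : ρ.reApplyInnerSelf (b i) = p i := reApplyInnerSelf_of_apply_eq_smul b (hρ i)
  have hfiber (N : ℕ) : ∑ i : {i : S → ℕ // deg i = N}, (deg (i : S → ℕ) : ℝ) ^ 2 * p i =
      ∑ k : {k : S → ℕ // deg k = N}, (deg (k : S → ℕ) : ℝ) ^ 2 * diag ρ k := by
    have hdeg (f : (S → ℕ) → ℝ) : ∑ k : {k : S → ℕ // deg k = N}, (deg (k : S → ℕ) : ℝ) ^ 2 * f k =
        (N : ℝ) ^ 2 * ∑ k : {k : S → ℕ // deg k = N}, f k := by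
      rw [Finset.mul_sum]
      exact Finset.sum_congr rfl fun k _ => by rw [k.2]
    rw [hdeg, hdeg, ← sum_fiber_reApplyInnerSelf hgr hcons N]
    simp only [hr]
  have hsum := hasSum_sum_fiber (deg := deg) hsq.hasSum
  simp only [hfiber] at hsum
  have hnonneg (k : S → ℕ) : 0 ≤ (deg k : ℝ) ^ 2 * diag ρ k :=
    mul_nonneg (sq_nonneg _) (reApplyInnerSelf_nonneg hpos _)
  exact ⟨hpos, hasSum_reApplyInnerSelf hpos ket (hp.congr_fun hr), hcons,
    (hasSum_of_hasSum_sum_fiber hnonneg hsum).summable⟩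

namespace IsState

variable {ρ : Fock S →L[ℂ] Fock S} (hρ : IsState ρ)
include hρ

theorem diag_nonneg (k : S → ℕ) : 0 ≤ diag ρ k :=
  reApplyInnerSelf_nonneg hρ.isPositive _

theorem summable_occ_sq (x : S) : Summable fun k : S → ℕ => (k x : ℝ) ^ 2 * diag ρ k := by
  refine hρ.summable_deg_sq.of_nonneg_of_le
    (fun k => mul_nonneg (sq_nonneg _) (hρ.diag_nonneg k)) fun k => ?_
  gcongr
  · exact hρ.diag_nonneg k
  · exact le_deg k x

theorem summable_occ (x : S) : Summable fun k : S → ℕ => k x * diag ρ k := by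
  refine (hρ.summable_occ_sq x).of_nonneg_of_le
    (fun k => mul_nonneg (Nat.cast_nonneg _) (hρ.diag_nonneg k)) fun k => ?_
  refine mul_le_mul_of_nonneg_right ?_ (hρ.diag_nonneg k)
  exact_mod_cast Nat.le_self_pow two_ne_zero (k x)

theorem hasSum_occMean (x : S) : HasSum (fun k : S → ℕ => k x * diag ρ k) (occMean ρ x) :=
  (hρ.summable_occ x).hasSum

theorem hasSum_occSqMean (x : S) :
    HasSum (fun k : S → ℕ => (k x : ℝ) ^ 2 * diag ρ k) (occSqMean ρ x) :=
  (hρ.summable_occ_sq x).hasSum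

theorem occMean_nonneg (x : S) : 0 ≤ occMean ρ x :=
  (hρ.hasSum_occMean x).nonneg fun k => mul_nonneg (Nat.cast_nonneg _) (hρ.diag_nonneg k)

theorem sq_occMean_le (x : S) : occMean ρ x ^ 2 ≤ occSqMean ρ x := by
  have hvar := ((hρ.hasSum_occSqMean x).sub ((hρ.hasSum_occMean x).mul_left (2 * occMean ρ x))).add
    (hρ.hasSum_diag.mul_left (occMean ρ x ^ 2))
  have hvar0 := hvar.nonneg fun k => by
    have := mul_nonneg (sq_nonneg ((k x : ℝ) - occMean ρ x)) (hρ.diag_nonneg k)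
    linarith
  linarith

theorem exists_graded_eigenbasis : ∃ b : HilbertBasis (S → ℕ) ℂ (Fock S), IsGradedBasis deg b ∧
    ∀ i, ρ (b i) = (ρ.reApplyInnerSelf (b i) : ℂ) • b i :=
  exists_graded_eigenbasis_of_isSelfAdjoint hρ.isPositive.isSelfAdjoint hρ.conserves

theorem hasSum_reApplyInnerSelf {ι : Type*} (c : HilbertBasis ι ℂ (Fock S)) :
    HasSum (fun i => ρ.reApplyInnerSelf (c i)) 1 :=
  BoseHubbard.hasSum_reApplyInnerSelf hρ.isPositive c hρ.hasSum_diag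

theorem entropy_le_cross {ι : Type*} (c : HilbertBasis ι ℂ (Fock S)) {q : ι → ℝ}
    (hq0 : ∀ i, 0 < q i) (hq : HasSum q 1) :
    entropy ρ ≤ ∑' i, ENNReal.ofReal (-Real.log (q i) * ρ.reApplyInnerSelf (c i)) := by
  obtain ⟨b, -, hb⟩ := hρ.exists_graded_eigenbasis
  have hp0 (i) := reApplyInnerSelf_nonneg hρ.isPositive (b i)
  have hp := hρ.hasSum_reApplyInnerSelf b
  rw [entropy_eq_tsum b hp0 hp hb]
  exact tsum_negMulLog_le b c hb hp0 hp hq0 hq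

theorem entropy_le :
    entropy ρ ≤ ENNReal.ofReal (∑ x, Real.log 2 * (occMean ρ x + 1)) := by
  have hcross : HasSum (fun k : S → ℕ =>
      -Real.log ((1 / 2) ^ (deg k + Fintype.card S)) * ρ.reApplyInnerSelf (ket k))
      (∑ x, Real.log 2 * (occMean ρ x + 1)) := by
    refine (hasSum_sum (s := Finset.univ) fun x _ =>
      ((hρ.hasSum_occMean x).add hρ.hasSum_diag).mul_left (Real.log 2)).congr_fun fun k => ?_
    rw [Real.log_pow, one_div, Real.log_inv, ← Finset.mul_sum, Finset.sum_add_distrib,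
      ← Finset.sum_mul, Finset.sum_const, nsmul_eq_mul, Finset.card_univ, deg]
    push_cast
    rw [diag]
    ring
  rw [← tsum_ofReal_eq_of_hasSum (fun k => ?_) hcross]
  · exact hρ.entropy_le_cross ket (fun k => by positivity) hasSum_half_pow_deg
  · refine mul_nonneg (neg_nonneg.2 (Real.log_nonpos (by positivity) ?_)) (hρ.diag_nonneg k)
    exact pow_le_one₀ (by norm_num) (by norm_num)

theorem entropy_ne_top : entropy ρ ≠ ∞ :=
  ne_top_of_le_ne_top ENNReal.ofReal_ne_top hρ.entropy_le

end IsState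

end States

/-! ### The energy of a state -/

section Energy

variable {S : Type} [Fintype S] [DecidableEq S]

/-- The real part of the expectation `tr(ρ a†ₓ a_y)` of a hopping term. -/
def hopExp (ρ : Fock S →L[ℂ] Fock S) (x y : S) : ℝ :=
  ∑' k, hopCoef x y k * (entry ρ (hop x y k) k).re

/-- The energy `tr(ρ H)` of a state `ρ`, in terms of the hopping expectations and of the first two
moments of the occupation numbers. -/
def energy (G : SimpleGraph S) [DecidableRel G.Adj] (J U μ : ℝ) (ρ : Fock S →L[ℂ] Fock S) : ℝ :=
  -J * ∑ d : G.Dart, hopExp ρ d.fst d.snd +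
    ∑ x, (U / 2 * (occSqMean ρ x - occMean ρ x) - μ * occMean ρ x)

namespace IsState

variable {ρ : Fock S →L[ℂ] Fock S} (hρ : IsState ρ)
include hρ

theorem abs_hopCoef_mul_entry_le {x y : S} (hxy : x ≠ y) (n : S → ℕ) :
    |hopCoef x y (n + Pi.single x 1) *
        (entry ρ (hop x y (n + Pi.single x 1)) (n + Pi.single x 1)).re| ≤
      ((n + Pi.single x 1 : S → ℕ) x * diag ρ (n + Pi.single x 1) +
        (n + Pi.single y 1 : S → ℕ) y * diag ρ (n + Pi.single y 1)) / 2 := by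
  rw [hop_add_single, hopCoef_add_single hxy]
  set c := (entry ρ (n + Pi.single y 1) (n + Pi.single x 1)).re
  set a := diag ρ (n + Pi.single y 1)
  set b := diag ρ (n + Pi.single x 1)
  have ha : 0 ≤ a := hρ.diag_nonneg _
  have hb : 0 ≤ b := hρ.diag_nonneg _
  have hc : c ^ 2 ≤ a * b := calc
    c ^ 2 ≤ ‖entry ρ (n + Pi.single y 1) (n + Pi.single x 1)‖ ^ 2 :=
      sq_le_sq.2 ((Complex.abs_re_le_norm _).trans (le_abs_self _))
    _ ≤ a * b := norm_entry_sq_le hρ.isPositive _ _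
  have hx : (0 : ℝ) ≤ n x + 1 := by positivity
  have hy : (0 : ℝ) ≤ n y + 1 := by positivity
  simp only [Pi.add_apply, Pi.single_eq_same, Nat.cast_add, Nat.cast_one]
  refine abs_le_of_sq_le_sq ?_ (by positivity)
  calc (√(n x + 1) * √(n y + 1) * c) ^ 2 = ((n x + 1) * (n y + 1)) * c ^ 2 := by
        rw [mul_pow, mul_pow, Real.sq_sqrt hx, Real.sq_sqrt hy]
    _ ≤ ((n x + 1) * (n y + 1)) * (a * b) := by gcongr
    _ ≤ (((n x + 1) * b + (n y + 1) * a) / 2) ^ 2 := by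
        linarith [sq_nonneg (((n x : ℝ) + 1) * b - (n y + 1) * a)]

theorem hasSum_occ_add_single (x : S) :
    HasSum (fun n : S → ℕ => (n + Pi.single x 1 : S → ℕ) x * diag ρ (n + Pi.single x 1))
      (occMean ρ x) :=
  (hasSum_add_single_iff (g := fun k : S → ℕ => k x * diag ρ k) fun k hk => by simp [hk]).2
    (hρ.hasSum_occMean x)

theorem hasSum_hopExp_add_single {x y : S} (hxy : x ≠ y) :
    HasSum (fun n : S → ℕ => hopCoef x y (n + Pi.single x 1) *
        (entry ρ (hop x y (n + Pi.single x 1)) (n + Pi.single x 1)).re) (hopExp ρ x y) := by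
  have hsum : Summable fun n : S → ℕ => hopCoef x y (n + Pi.single x 1) *
        (entry ρ (hop x y (n + Pi.single x 1)) (n + Pi.single x 1)).re :=
    Summable.of_norm_bounded
      (((hρ.hasSum_occ_add_single x).add (hρ.hasSum_occ_add_single y)).div_const 2).summable
      (hρ.abs_hopCoef_mul_entry_le hxy)
  have h := (hasSum_add_single_iff (g := fun k => hopCoef x y k * (entry ρ (hop x y k) k).re)
    fun k hk => by rw [hopCoef_eq_zero hk, zero_mul]).1 hsum.hasSum
  rw [hopExp, h.tsum_eq]
  exact hsum.hasSum

theorem hasSum_hopExp {x y : S} (hxy : x ≠ y) :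
    HasSum (fun k => hopCoef x y k * (entry ρ (hop x y k) k).re) (hopExp ρ x y) :=
  (hasSum_add_single_iff fun k hk => by rw [hopCoef_eq_zero hk, zero_mul]).1
    (hρ.hasSum_hopExp_add_single hxy)

theorem abs_hopExp_le {x y : S} (hxy : x ≠ y) :
    |hopExp ρ x y| ≤ (occMean ρ x + occMean ρ y) / 2 := by
  rw [← (hρ.hasSum_hopExp_add_single hxy).tsum_eq, ← Real.norm_eq_abs]
  exact tsum_of_norm_bounded
    (((hρ.hasSum_occ_add_single x).add (hρ.hasSum_occ_add_single y)).div_const 2)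
    (hρ.abs_hopCoef_mul_entry_le hxy)

variable (G : SimpleGraph S) [DecidableRel G.Adj] (J U μ : ℝ)

theorem hasSum_energy :
    HasSum (fun k => (hamiltonianExpr G J U μ (ρ (ket k)) k).re) (energy G J U μ ρ) := by
  have hhop := (hasSum_sum (s := Finset.univ) fun (d : G.Dart) _ =>
    hρ.hasSum_hopExp d.adj.ne).mul_left (-J)
  have hocc := hasSum_sum (s := Finset.univ) fun (x : S) _ =>
    (((hρ.hasSum_occSqMean x).sub (hρ.hasSum_occMean x)).mul_left (U / 2)).sub
      ((hρ.hasSum_occMean x).mul_left μ)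
  refine (hhop.add hocc).congr_fun fun k => ?_
  have hre : (ρ (ket k) k).re = diag ρ k := re_entry_self ρ k
  rw [hamiltonianExpr_apply, Complex.add_re, ← Complex.ofReal_neg, Complex.re_ofReal_mul,
    Complex.re_ofReal_mul, Complex.re_sum, hre, diagEnergy, Finset.sum_mul]
  congr 1
  · exact congrArg _ (Finset.sum_congr rfl fun d _ => Complex.re_ofReal_mul _ _)
  · exact Finset.sum_congr rfl fun x _ => by ring

theorem sum_abs_hopExp_le {Δ : ℕ} (hΔ : ∀ x, G.degree x ≤ Δ) :
    ∑ d : G.Dart, |hopExp ρ d.fst d.snd| ≤ Δ * ∑ x, occMean ρ x := calc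
  ∑ d : G.Dart, |hopExp ρ d.fst d.snd|
      ≤ ∑ d : G.Dart, (occMean ρ d.fst + occMean ρ d.snd) / 2 :=
        Finset.sum_le_sum fun d _ => hρ.abs_hopExp_le d.adj.ne
  _ = ∑ x, G.degree x * occMean ρ x := by
        rw [← Finset.sum_div, Finset.sum_add_distrib, sum_dart_snd G (occMean ρ),
          sum_dart_fst G (occMean ρ), add_self_div_two]
  _ ≤ Δ * ∑ x, occMean ρ x := by
        rw [Finset.mul_sum]
        refine Finset.sum_le_sum fun x _ => mul_le_mul_of_nonneg_right ?_ (hρ.occMean_nonneg x)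
        exact_mod_cast hΔ x

variable {U}

theorem sum_occMean_le_energy {Δ : ℕ} (hΔ : ∀ x, G.degree x ≤ Δ) (hU : 0 ≤ U) :
    ∑ x, (U / 2 * (occMean ρ x ^ 2 - occMean ρ x) - (Δ * |J| + μ) * occMean ρ x) ≤
      energy G J U μ ρ := by
  have hkin : J * ∑ d : G.Dart, hopExp ρ d.fst d.snd ≤ |J| * (Δ * ∑ x, occMean ρ x) := calc
    J * ∑ d : G.Dart, hopExp ρ d.fst d.snd ≤ |J| * |∑ d : G.Dart, hopExp ρ d.fst d.snd| := by
        rw [← abs_mul]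
        exact le_abs_self _
    _ ≤ |J| * (Δ * ∑ x, occMean ρ x) := by
        gcongr
        exact (Finset.abs_sum_le_sum_abs _ _).trans (hρ.sum_abs_hopExp_le G hΔ)
  calc ∑ x, (U / 2 * (occMean ρ x ^ 2 - occMean ρ x) - (Δ * |J| + μ) * occMean ρ x)
      = -(|J| * (Δ * ∑ x, occMean ρ x)) +
          ∑ x, (U / 2 * (occMean ρ x ^ 2 - occMean ρ x) - μ * occMean ρ x) := by
        rw [Finset.mul_sum, Finset.mul_sum, ← Finset.sum_neg_distrib, ← Finset.sum_add_distrib]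
        exact Finset.sum_congr rfl fun x _ => by ring
    _ ≤ energy G J U μ ρ := by
        rw [energy]
        gcongr with x
        · linarith
        · exact hρ.sq_occMean_le x

end IsState

end Energy

/-! ### Growth of the energy levels -/

section Spectrum

variable {S : Type} [Fintype S]

namespace IsState

variable {ρ : Fock S →L[ℂ] Fock S} (hρ : IsState ρ)
include hρ

theorem hasSum_deg_mul_reApplyInnerSelf {b : HilbertBasis (S → ℕ) ℂ (Fock S)}
    (hgr : IsGradedBasis deg b) :
    HasSum (fun i => deg i * ρ.reApplyInnerSelf (b i)) (∑ x, occMean ρ x) := by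
  have hocc : HasSum (fun k : S → ℕ => deg k * diag ρ k) (∑ x, occMean ρ x) := by
    refine (hasSum_sum (s := Finset.univ) fun x _ => hρ.hasSum_occMean x).congr_fun fun k => ?_
    rw [← Finset.sum_mul, deg, Nat.cast_sum]
  have hfiber (N : ℕ) (f : (S → ℕ) → ℝ) : ∑ k : {k : S → ℕ // deg k = N}, deg (k : S → ℕ) * f k =
      N * ∑ k : {k : S → ℕ // deg k = N}, f k := by
    rw [Finset.mul_sum]
    exact Finset.sum_congr rfl fun k _ => by rw [k.2]
  have hnonneg (i : S → ℕ) : 0 ≤ deg i * ρ.reApplyInnerSelf (b i) :=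
    mul_nonneg (Nat.cast_nonneg _) (reApplyInnerSelf_nonneg hρ.isPositive _)
  refine hasSum_of_hasSum_sum_fiber (deg := deg) hnonneg
    ((hasSum_sum_fiber (deg := deg) hocc).congr_fun fun N => ?_)
  rw [hfiber N fun i => ρ.reApplyInnerSelf (b i), hfiber N (diag ρ),
    sum_fiber_reApplyInnerSelf hgr hρ.conserves]

end IsState

theorem exists_isState_reApplyInnerSelf_eq_zero {b : HilbertBasis (S → ℕ) ℂ (Fock S)}
    (hgr : IsGradedBasis deg b) (i : S → ℕ) :
    ∃ ρ : Fock S →L[ℂ] Fock S, IsState ρ ∧ ∀ j, j ≠ i → ρ.reApplyInnerSelf (b j) = 0 := by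
  classical
  let p : (S → ℕ) → ℝ := Pi.single i 1
  have hp (j : S → ℕ) (hj : j ≠ i) : p j = 0 := Pi.single_eq_of_ne hj 1
  have hsum : HasSum p 1 := by simpa [p] using hasSum_single i hp
  have hsq : Summable fun j => (deg j : ℝ) ^ 2 * p j :=
    (hasSum_single i fun j hj => by rw [hp j hj, mul_zero]).summable
  obtain ⟨ρ, hρ⟩ := exists_diagonal b hsum.summable
  refine ⟨ρ, isState_of_graded_eigenbasis hgr hρ (fun j => ?_) hsum hsq, fun j hj => ?_⟩
  · exact (Pi.single_nonneg (i := i) (α := fun _ : S → ℕ => ℝ)).2 zero_le_one j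
  · rw [reApplyInnerSelf_of_apply_eq_smul b (hρ j), hp j hj]

namespace IsEnergyBasis

variable [DecidableEq S] {G : SimpleGraph S} {J U μ : ℝ}
  {b : HilbertBasis (S → ℕ) ℂ (Fock S)} {ε : (S → ℕ) → ℝ} (hb : IsEnergyBasis G J U μ b ε)
include hb

theorem hasSum_sum_fiber_energy [DecidableRel G.Adj] {ρ : Fock S →L[ℂ] Fock S} (hρ : IsState ρ) :
    HasSum (fun N => ∑ i : {i : S → ℕ // deg i = N}, ε i * ρ.reApplyInnerSelf (b i))
      (energy G J U μ ρ) :=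
  (hasSum_sum_fiber (deg := deg) (hρ.hasSum_energy G J U μ)).congr_fun fun N =>
    sum_fiber_eigenvalue_mul (H := hamiltonianExpr G J U μ ∘ₗ toFunₗ) hb.graded hb.apply
      hρ.conserves N

theorem exists_isState_energy_eq [DecidableRel G.Adj] (i : S → ℕ) :
    ∃ ρ : Fock S →L[ℂ] Fock S, IsState ρ ∧ energy G J U μ ρ = ε i ∧ ∑ x, occMean ρ x = deg i := by
  obtain ⟨ρ, hρ, hzero⟩ := exists_isState_reApplyInnerSelf_eq_zero hb.graded i
  have hone : ρ.reApplyInnerSelf (b i) = 1 :=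
    (hasSum_single i hzero).unique (hρ.hasSum_reApplyInnerSelf b)
  have hsum (f : (S → ℕ) → ℝ) : HasSum (fun j => f j * ρ.reApplyInnerSelf (b j)) (f i) := by
    have h := hasSum_single (f := fun j => f j * ρ.reApplyInnerSelf (b j)) i fun j hj => by
      rw [hzero j hj, mul_zero]
    rwa [hone, mul_one] at h
  have hfiber := hasSum_sum_fiber (deg := deg) (hsum ε)
  have henergy : energy G J U μ ρ = ε i := (hb.hasSum_sum_fiber_energy hρ).unique hfiber
  have hocc : ∑ x, occMean ρ x = deg i :=
    (hρ.hasSum_deg_mul_reApplyInnerSelf hb.graded).unique (hsum fun j => (deg j : ℝ))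
  exact ⟨ρ, hρ, henergy, hocc⟩

theorem exists_mul_deg_sub_le (hU : 0 < U) (K : ℝ) : ∃ C, ∀ i, K * deg i - C ≤ ε i := by
  classical
  obtain ⟨a, ha⟩ : ∃ a, a = U / 2 + (G.maxDegree * |J| + μ) + K := ⟨_, rfl⟩
  refine ⟨∑ _x : S, a ^ 2 / (2 * U), fun i => ?_⟩
  obtain ⟨ρ, hρ, hen, hocc⟩ := hb.exists_isState_energy_eq i
  rw [← hen, ← hocc, Finset.mul_sum, ← Finset.sum_sub_distrib]
  refine le_trans (Finset.sum_le_sum fun x _ => ?_)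
    (hρ.sum_occMean_le_energy G J μ G.degree_le_maxDegree hU.le)
  have hsq : 0 ≤ U / 2 * (occMean ρ x - a / U) ^ 2 := by positivity
  have hexpand : U / 2 * (occMean ρ x - a / U) ^ 2 =
      U / 2 * occMean ρ x ^ 2 - a * occMean ρ x + a ^ 2 / (2 * U) := by
    field_simp
    ring
  have hlinear : a * occMean ρ x = U / 2 * occMean ρ x +
      (G.maxDegree * |J| + μ) * occMean ρ x + K * occMean ρ x := by
    rw [ha, add_mul, add_mul]
  linarith

variable {β : ℝ}

theorem summable_sq_mul_exp (hU : 0 < U) (hβ : 0 < β) :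
    Summable fun i => ((deg i : ℝ) + 1) ^ 2 * Real.exp (-β * ε i) := by
  obtain ⟨C, hC⟩ := hb.exists_mul_deg_sub_le hU (Real.log 8 / β)
  refine Summable.of_nonneg_of_le (fun i => by positivity) (fun i => ?_)
    ((hasSum_half_pow_deg (S := S)).summable.mul_left (Real.exp (β * C) * 2 ^ Fintype.card S))
  have hpow : (deg i : ℝ) + 1 ≤ 2 ^ deg i := by exact_mod_cast Nat.lt_two_pow_self
  have hexp : Real.exp (-β * ε i) ≤ Real.exp (β * C) * (1 / 8) ^ deg i := by
    rw [one_div, ← Real.exp_log (show (0 : ℝ) < 8⁻¹ by norm_num), ← Real.exp_nat_mul,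
      ← Real.exp_add, Real.exp_le_exp, Real.log_inv]
    have h := mul_le_mul_of_nonneg_left (hC i) hβ.le
    have hcancel : β * (Real.log 8 / β * deg i - C) = Real.log 8 * deg i - β * C := by field_simp
    linarith
  calc ((deg i : ℝ) + 1) ^ 2 * Real.exp (-β * ε i)
      ≤ (2 ^ deg i) ^ 2 * (Real.exp (β * C) * (1 / 8) ^ deg i) := by gcongr
    _ = Real.exp (β * C) * 2 ^ Fintype.card S * (1 / 2) ^ (deg i + Fintype.card S) := by
        have h8 : (1 / 8 : ℝ) = 2⁻¹ ^ 3 := by norm_num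
        rw [h8, pow_right_comm (2⁻¹ : ℝ), one_div, pow_add]
        simp only [inv_pow]
        field_simp

theorem summable_exp (hU : 0 < U) (hβ : 0 < β) : Summable fun i => Real.exp (-β * ε i) := by
  refine (hb.summable_sq_mul_exp hU hβ).of_nonneg_of_le (fun i => by positivity) fun i => ?_
  exact le_mul_of_one_le_left (Real.exp_pos _).le (one_le_pow₀ (by simp))

theorem summable_deg_sq_mul_exp (hU : 0 < U) (hβ : 0 < β) :
    Summable fun i => (deg i : ℝ) ^ 2 * Real.exp (-β * ε i) := by
  refine (hb.summable_sq_mul_exp hU hβ).of_nonneg_of_le (fun i => by positivity) fun i => ?_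
  gcongr
  linarith

theorem hasSum_energy [DecidableRel G.Adj] (hU : 0 < U) {ρ : Fock S →L[ℂ] Fock S}
    (hρ : IsState ρ) :
    HasSum (fun i => ε i * ρ.reApplyInnerSelf (b i)) (energy G J U μ ρ) := by
  obtain ⟨C, hC⟩ := hb.exists_mul_deg_sub_le hU 0
  have htr := (hρ.hasSum_reApplyInnerSelf b).mul_left C
  have hnonneg (i : S → ℕ) : 0 ≤ (ε i + C) * ρ.reApplyInnerSelf (b i) :=
    mul_nonneg (by linarith [hC i]) (reApplyInnerSelf_nonneg hρ.isPositive _)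
  have hshift : HasSum (fun i => (ε i + C) * ρ.reApplyInnerSelf (b i))
      (energy G J U μ ρ + C * 1) := by
    have h := (hb.hasSum_sum_fiber_energy hρ).add (hasSum_sum_fiber (deg := deg) htr)
    refine hasSum_of_hasSum_sum_fiber (deg := deg) hnonneg (h.congr_fun fun N => ?_)
    rw [← Finset.sum_add_distrib]
    exact Finset.sum_congr rfl fun i _ => add_mul _ _ _
  have h := hshift.sub htr
  rw [add_sub_cancel_right] at h
  exact h.congr_fun fun i => by ring

end IsEnergyBasis

end Spectrum

/-! ### The Gibbs state -/

section Gibbs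

/-- The partition function `∑ᵢ e^{-βεᵢ}` of the energy levels `ε`. -/
def partitionFunction {κ : Type} (β : ℝ) (ε : κ → ℝ) : ℝ := ∑' i, Real.exp (-β * ε i)

/-- The Boltzmann weight `e^{-βεᵢ} / Z`. -/
def gibbsWeight {κ : Type} (β : ℝ) (ε : κ → ℝ) (i : κ) : ℝ :=
  Real.exp (-β * ε i) / partitionFunction β ε

variable {S : Type} [Fintype S] [DecidableEq S]

theorem hamiltonianExpr_ket_zero (G : SimpleGraph S) (J U μ : ℝ) :
    hamiltonianExpr G J U μ (ket 0 : Fock S) = 0 := by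
  classical
  funext k
  by_cases hk : k = 0
  · rw [hamiltonianExpr_apply, hk]
    simp [hopCoef_eq_zero, diagEnergy]
  · refine hamiltonianExpr_ket_eq_zero G J U μ fun h => hk ?_
    simpa [deg, funext_iff] using h

namespace IsEnergyBasis

variable {G : SimpleGraph S} {J U μ : ℝ} {b : HilbertBasis (S → ℕ) ℂ (Fock S)}
  {ε : (S → ℕ) → ℝ} (hb : IsEnergyBasis G J U μ b ε) {β : ℝ}
include hb

theorem exists_eq_zero : ∃ i, ε i = 0 := by
  obtain ⟨i, hi⟩ : ∃ i, ⟪b i, ket (0 : S → ℕ)⟫_ℂ ≠ 0 := by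
    by_contra! h
    refine ket.orthonormal.ne_zero (0 : S → ℕ) ((hasSum_inner_smul b _).unique ?_)
    simpa only [h, zero_smul] using hasSum_zero
  refine ⟨i, hb.eq_of_inner_ne_zero (ψ := ket 0) ?_ hi⟩
  rw [hamiltonianExpr_ket_zero, Complex.ofReal_zero, zero_smul]

section Weights

variable (hU : 0 < U) (hβ : 0 < β)
include hU hβ

theorem hasSum_exp : HasSum (fun i => Real.exp (-β * ε i)) (partitionFunction β ε) :=
  (hb.summable_exp hU hβ).hasSum

theorem one_le_partitionFunction : 1 ≤ partitionFunction β ε := by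
  obtain ⟨i, hi⟩ := hb.exists_eq_zero
  simpa [hi] using le_hasSum (hb.hasSum_exp hU hβ) i fun j _ => (Real.exp_pos _).le

theorem gibbsWeight_pos (i : S → ℕ) : 0 < gibbsWeight β ε i :=
  div_pos (Real.exp_pos _) (one_pos.trans_le (hb.one_le_partitionFunction hU hβ))

theorem hasSum_gibbsWeight : HasSum (gibbsWeight β ε) 1 := by
  have h := (hb.hasSum_exp hU hβ).div_const (partitionFunction β ε)
  rwa [div_self (one_pos.trans_le (hb.one_le_partitionFunction hU hβ)).ne'] at h

theorem gibbsWeight_le_one (i : S → ℕ) : gibbsWeight β ε i ≤ 1 :=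
  le_hasSum (hb.hasSum_gibbsWeight hU hβ) i fun j _ => (hb.gibbsWeight_pos hU hβ j).le

theorem log_gibbsWeight (i : S → ℕ) :
    Real.log (gibbsWeight β ε i) = -(β * ε i + Real.log (partitionFunction β ε)) := by
  rw [gibbsWeight, Real.log_div (Real.exp_pos _).ne'
    (one_pos.trans_le (hb.one_le_partitionFunction hU hβ)).ne', Real.log_exp]
  ring

theorem posTrace_eq {T : Fock S →L[ℂ] Fock S} (hT : IsHeatOperator (hamiltonian G J U μ) β T) :
    posTrace T = ENNReal.ofReal (partitionFunction β ε) := by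
  rw [posTrace_eq_tsum_eigenvalue b (fun i => (Real.exp_pos _).le) (hb.isHeatOperator_iff.1 hT)]
  exact tsum_ofReal_eq_of_hasSum (fun i => (Real.exp_pos _).le) (hb.hasSum_exp hU hβ)

theorem toReal_posTrace_eq {T : Fock S →L[ℂ] Fock S}
    (hT : IsHeatOperator (hamiltonian G J U μ) β T) :
    (posTrace T).toReal = partitionFunction β ε := by
  rw [hb.posTrace_eq hU hβ hT, ENNReal.toReal_ofReal
    (zero_le_one.trans (hb.one_le_partitionFunction hU hβ))]

theorem exists_isGibbsState : ∃ ρ, IsGibbsState (hamiltonian G J U μ) β ρ := by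
  obtain ⟨T, hT⟩ := exists_diagonal b (hb.summable_exp hU hβ)
  have hheat := hb.isHeatOperator_iff.2 hT
  exact ⟨_, T, hheat, hb.posTrace_eq hU hβ hheat ▸ ENNReal.ofReal_ne_top, rfl⟩

theorem gibbs_apply {ρ : Fock S →L[ℂ] Fock S} (hρ : IsGibbsState (hamiltonian G J U μ) β ρ)
    (i : S → ℕ) : ρ (b i) = (gibbsWeight β ε i : ℂ) • b i := by
  obtain ⟨T, hT, -, rfl⟩ := hρ
  rw [smul_apply, hb.isHeatOperator_iff.1 hT, smul_smul,
    hb.toReal_posTrace_eq hU hβ hT, ← Complex.ofReal_mul, gibbsWeight, div_eq_inv_mul]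

theorem isState_gibbs {ρ : Fock S →L[ℂ] Fock S} (hρ : IsGibbsState (hamiltonian G J U μ) β ρ) :
    IsState ρ := by
  refine isState_of_graded_eigenbasis hb.graded (hb.gibbs_apply hU hβ hρ)
    (fun i => (hb.gibbsWeight_pos hU hβ i).le) (hb.hasSum_gibbsWeight hU hβ) ?_
  exact ((hb.summable_deg_sq_mul_exp hU hβ).div_const (partitionFunction β ε)).congr
    fun i => mul_div_assoc _ _ _

variable [DecidableRel G.Adj] {ρ : Fock S →L[ℂ] Fock S}

theorem hasSum_neg_log_gibbsWeight_mul (hρ : IsState ρ) :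
    HasSum (fun i => -Real.log (gibbsWeight β ε i) * ρ.reApplyInnerSelf (b i))
      (β * energy G J U μ ρ + Real.log (partitionFunction β ε)) := by
  have h := ((hb.hasSum_energy hU hρ).mul_left β).add
    ((hρ.hasSum_reApplyInnerSelf b).mul_left (Real.log (partitionFunction β ε)))
  rw [mul_one] at h
  refine h.congr_fun fun i => ?_
  rw [hb.log_gibbsWeight hU hβ]
  ring

omit [DecidableRel G.Adj] in
theorem neg_log_gibbsWeight_mul_nonneg (hρ : IsState ρ) (i : S → ℕ) :
    0 ≤ -Real.log (gibbsWeight β ε i) * ρ.reApplyInnerSelf (b i) :=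
  mul_nonneg (neg_nonneg.2 (Real.log_nonpos (hb.gibbsWeight_pos hU hβ i).le
    (hb.gibbsWeight_le_one hU hβ i))) (reApplyInnerSelf_nonneg hρ.isPositive _)

theorem tsum_neg_log_gibbsWeight_mul (hρ : IsState ρ) :
    ∑' i, ENNReal.ofReal (-Real.log (gibbsWeight β ε i) * ρ.reApplyInnerSelf (b i)) =
      ENNReal.ofReal (β * energy G J U μ ρ + Real.log (partitionFunction β ε)) :=
  tsum_ofReal_eq_of_hasSum (hb.neg_log_gibbsWeight_mul_nonneg hU hβ hρ)
    (hb.hasSum_neg_log_gibbsWeight_mul hU hβ hρ)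

theorem mul_energy_add_log_nonneg (hρ : IsState ρ) :
    0 ≤ β * energy G J U μ ρ + Real.log (partitionFunction β ε) :=
  (hb.hasSum_neg_log_gibbsWeight_mul hU hβ hρ).nonneg (hb.neg_log_gibbsWeight_mul_nonneg hU hβ hρ)

theorem entropy_le (hρ : IsState ρ) : (entropy ρ).toReal ≤
    β * energy G J U μ ρ + Real.log (partitionFunction β ε) := by
  refine ENNReal.toReal_le_of_le_ofReal (hb.mul_energy_add_log_nonneg hU hβ hρ) ?_
  rw [← hb.tsum_neg_log_gibbsWeight_mul hU hβ hρ]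
  exact hρ.entropy_le_cross b (hb.gibbsWeight_pos hU hβ) (hb.hasSum_gibbsWeight hU hβ)

theorem entropy_gibbs_eq (hρ : IsGibbsState (hamiltonian G J U μ) β ρ) :
    (entropy ρ).toReal = β * energy G J U μ ρ + Real.log (partitionFunction β ε) := by
  have hstate := hb.isState_gibbs hU hβ hρ
  have happly := hb.gibbs_apply hU hβ hρ
  rw [entropy_eq_tsum b (fun i => (hb.gibbsWeight_pos hU hβ i).le) (hb.hasSum_gibbsWeight hU hβ)
    happly, ← ENNReal.toReal_ofReal (hb.mul_energy_add_log_nonneg hU hβ hstate),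
    ← hb.tsum_neg_log_gibbsWeight_mul hU hβ hstate]
  congr 2 with i
  rw [reApplyInnerSelf_of_apply_eq_smul b (happly i), Real.negMulLog_eq_neg, neg_mul, mul_comm]

end Weights

end IsEnergyBasis

end Gibbs

/-! ### Graph automorphisms -/

section Symmetry

variable {S : Type}

/-- Permutation of the sites of a wave function by `φ`, as an operator on the Fock space. -/
def permute (φ : Equiv.Perm S) : Fock S →L[ℂ] Fock S :=
  LinearMap.mkContinuous
    { toFun := fun ψ => ⟨fun k => ψ (k ∘ φ),
        memℓp_gen' (sum_norm_rpow_comp_le _ φ.surjective.injective_comp_right ψ)⟩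
      map_add' := fun _ _ => rfl
      map_smul' := fun _ _ => rfl }
    1
    fun ψ => by
      rw [one_mul]
      exact lp.norm_le_of_forall_sum_le (by norm_num) (norm_nonneg _)
        (sum_norm_rpow_comp_le _ φ.surjective.injective_comp_right ψ)

theorem permute_apply (φ : Equiv.Perm S) (ψ : Fock S) (k : S → ℕ) :
    permute φ ψ k = ψ (k ∘ φ) := rfl

theorem permute_ket (φ : Equiv.Perm S) (k : S → ℕ) : permute φ (ket (k ∘ φ)) = ket k := by
  classical
  refine lp.ext (funext fun l => ?_)
  simp only [permute_apply, ket_apply, φ.surjective.injective_comp_right.eq_iff]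

theorem hop_comp [DecidableEq S] (φ : Equiv.Perm S) (x y : S) (k : S → ℕ) :
    hop (φ x) (φ y) k ∘ φ = hop x y (k ∘ φ) := by
  have hsingle (x : S) : (Pi.single (φ x) 1 : S → ℕ) ∘ φ = Pi.single x 1 := by
    funext y
    simp [Pi.single_apply]
  rw [hop, hop, ← hsingle x, ← hsingle y]
  rfl

variable [Fintype S] {G : SimpleGraph S}

theorem sum_dart_comp [DecidableRel G.Adj] {M : Type*} [AddCommMonoid M] (φ : G ≃g G)
    (f : S → S → M) :
    ∑ d : G.Dart, f (φ d.fst) (φ d.snd) = ∑ d : G.Dart, f d.fst d.snd := by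
  rw [← sum_adj_eq_sum_dart G f, ← sum_adj_eq_sum_dart G fun x y => f (φ x) (φ y),
    ← φ.toEquiv.sum_comp fun x => ∑ y, if G.Adj x y then f x y else 0]
  refine Finset.sum_congr rfl fun x _ => ?_
  rw [← φ.toEquiv.sum_comp fun y => if G.Adj (φ.toEquiv x) y then f (φ.toEquiv x) y else 0]
  exact Finset.sum_congr rfl fun y _ => if_congr φ.map_adj_iff.symm rfl rfl

variable [DecidableEq S]

theorem hamiltonianExpr_comp (J U μ : ℝ) (φ : G ≃g G) (ψ : (S → ℕ) → ℂ) (k : S → ℕ) :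
    hamiltonianExpr G J U μ (fun l => ψ (l ∘ φ)) k = hamiltonianExpr G J U μ ψ (k ∘ φ) := by
  classical
  have hdiag : diagEnergy U μ k = diagEnergy U μ (k ∘ φ) :=
    (φ.toEquiv.sum_comp fun x => U / 2 * (k x * (k x - 1)) - μ * k x).symm
  rw [hamiltonianExpr_apply, hamiltonianExpr_apply, hdiag,
    ← sum_dart_comp φ fun x y => (hopCoef x y k : ℂ) * ψ (hop x y k ∘ φ)]
  exact congrArg (fun s => -J * s + diagEnergy U μ (k ∘ φ) * ψ (k ∘ φ))
    (Finset.sum_congr rfl fun d _ => congrArg (fun l => _ * ψ l) (hop_comp φ.toEquiv _ _ k))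

theorem permute_comp_heat {J U μ β : ℝ} {T : Fock S →L[ℂ] Fock S}
    (hT : IsHeatOperator (hamiltonian G J U μ) β T) (φ : G ≃g G) :
    permute φ.toEquiv ∘L T = T ∘L permute φ.toEquiv := by
  obtain ⟨b, ε, hb⟩ := exists_isEnergyBasis G J U μ
  have hTb := hb.isHeatOperator_iff.1 hT
  refine ext_of_hilbertBasis b fun i => ?_
  have heigen : hamiltonianExpr G J U μ (permute φ.toEquiv (b i)) =
      (ε i : ℂ) • permute φ.toEquiv (b i) := by
    funext k
    exact (hamiltonianExpr_comp J U μ φ (b i) k).trans (congrFun (hb.apply i) (k ∘ φ))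
  rw [ContinuousLinearMap.comp_apply, ContinuousLinearMap.comp_apply, hTb, map_smul]
  refine (apply_eq_smul_of_inner_ne_zero b hTb fun j hj => ?_).symm
  rw [hb.eq_of_inner_ne_zero heigen hj]

theorem diag_comp {J U μ β : ℝ} {ρ : Fock S →L[ℂ] Fock S}
    (hρ : IsGibbsState (hamiltonian G J U μ) β ρ) (φ : G ≃g G) (k : S → ℕ) :
    diag ρ (k ∘ φ) = diag ρ k := by
  obtain ⟨T, hT, -, rfl⟩ := hρ
  have h : permute φ.toEquiv (T (ket (k ∘ φ))) = T (ket k) := by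
    rw [← permute_ket φ.toEquiv k]
    exact congrArg (fun A => A (ket (k ∘ φ))) (permute_comp_heat hT φ)
  have hT : entry T (k ∘ φ) (k ∘ φ) = entry T k k := congrArg (fun ψ : Fock S => ψ k) h
  rw [← re_entry_self, ← re_entry_self]
  exact congrArg (fun z => ((((posTrace T).toReal⁻¹ : ℝ) : ℂ) * z).re) hT

theorem occMean_apply_eq {J U μ β : ℝ} {ρ : Fock S →L[ℂ] Fock S}
    (hρ : IsGibbsState (hamiltonian G J U μ) β ρ) (φ : G ≃g G) (x : S) :
    occMean ρ (φ x) = occMean ρ x := by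
  rw [occMean, occMean,
    ← (φ.toEquiv.symm.arrowCongr (Equiv.refl ℕ)).tsum_eq fun k : S → ℕ => k x * diag ρ k]
  exact tsum_congr fun k => congrArg ((k (φ x) : ℝ) * ·) (diag_comp hρ φ k).symm

end Symmetry

/-! ### Reduced density matrices -/

section Glue

variable {S : Type} {X : Set S}

theorem glue_of_mem (m : ↥Xᶜ → ℕ) (k : X → ℕ) {x : S} (h : x ∈ X) :
    glue X m k x = k ⟨x, h⟩ := by simp [glue, h]

theorem glue_of_notMem (m : ↥Xᶜ → ℕ) (k : X → ℕ) {x : S} (h : x ∉ X) :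
    glue X m k x = m ⟨x, h⟩ := by simp [glue, h]

theorem glue_coe (m : ↥Xᶜ → ℕ) (k : X → ℕ) (x : X) : glue X m k x = k x :=
  glue_of_mem m k x.2

variable (X) in
/-- A configuration is a pair of a configuration on `X` and a configuration off `X`. -/
def glueEquiv : (X → ℕ) × (↥Xᶜ → ℕ) ≃ (S → ℕ) where
  toFun p := glue X p.2 p.1
  invFun n := (fun x => n x, fun x => n x)
  left_inv p := Prod.ext (funext fun x => glue_of_mem _ _ x.2)
    (funext fun x => glue_of_notMem _ _ x.2)
  right_inv n := funext fun x => by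
    by_cases h : x ∈ X
    · exact glue_of_mem _ _ h
    · exact glue_of_notMem _ _ h

theorem deg_glue [Fintype S] [Fintype X] [Fintype ↥Xᶜ] (m : ↥Xᶜ → ℕ) (k : X → ℕ) :
    deg (glue X m k) = deg k + deg m := by
  classical
  rw [deg, deg, deg, ← Fintype.sum_subtype_add_sum_subtype (fun x => x ∈ X) (glue X m k)]
  congr 1
  · exact Finset.sum_congr (Finset.ext fun x => by simp) fun x _ => glue_of_mem m k x.2
  · exact Finset.sum_congr (Finset.ext fun x => by simp) fun x _ => glue_of_notMem m k x.2

theorem slice_adjoint_ket (m : ↥Xᶜ → ℕ) (k : X → ℕ) :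
    (slice X m).adjoint (ket k) = ket (glue X m k) := by
  refine ext_inner_right ℂ fun ψ => ?_
  rw [ContinuousLinearMap.adjoint_inner_left, inner_ket_left, inner_ket_left]
  rfl

theorem entry_slice (ρ : Fock S →L[ℂ] Fock S) (m : ↥Xᶜ → ℕ) (k l : X → ℕ) :
    entry (slice X m ∘L ρ ∘L (slice X m).adjoint) k l = entry ρ (glue X m k) (glue X m l) := by
  rw [entry, ContinuousLinearMap.comp_apply, ContinuousLinearMap.comp_apply, slice_adjoint_ket]
  rfl

theorem hopCoef_glue (x y : X) (m : ↥Xᶜ → ℕ) (k : X → ℕ) :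
    hopCoef (x : S) (y : S) (glue X m k) = hopCoef x y k := by
  rw [hopCoef, hopCoef, glue_coe, glue_coe]

variable [DecidableEq S]

theorem hop_glue (x y : X) (m : ↥Xᶜ → ℕ) (k : X → ℕ) :
    hop (x : S) (y : S) (glue X m k) = glue X m (hop x y k) := by
  funext z
  by_cases hz : z ∈ X
  · rw [glue_of_mem m _ hz, hop, hop]
    simp [glue_of_mem m k hz, Pi.single_apply, Subtype.ext_iff]
  · have hzx : z ≠ x := fun h => hz (h ▸ x.2)
    have hzy : z ≠ y := fun h => hz (h ▸ y.2)
    rw [glue_of_notMem m _ hz, hop]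
    simp [glue_of_notMem m k hz, hzx, hzy]

end Glue

section Reduced

theorem isPositive_reduced {S : Type} (X : Set S) {ρ : Fock S →L[ℂ] Fock S} (hρ : ρ.IsPositive) :
    (reduced X ρ).IsPositive := by
  rw [← ContinuousLinearMap.nonneg_iff_isPositive]
  exact tsum_nonneg fun m =>
    (ContinuousLinearMap.nonneg_iff_isPositive _).2 (hρ.conj_adjoint (slice X m))

namespace IsState

variable {S : Type} [Fintype S] {ρ : Fock S →L[ℂ] Fock S} (hρ : IsState ρ) (X : Set S)
include hρ

theorem summable_slice :
    Summable fun m : ↥Xᶜ → ℕ => slice X m ∘L ρ ∘L (slice X m).adjoint := by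
  have hsum := ((Equiv.prodComm _ _).trans (glueEquiv X)).hasSum_iff.2 hρ.hasSum_diag |>.summable
  refine Summable.of_norm_bounded hsum.prod fun m => ?_
  refine norm_le_of_hasSum_reApplyInnerSelf (hρ.isPositive.conj_adjoint (slice X m))
    (b := ket) ?_
  refine (hsum.prod_factor m).hasSum.congr_fun fun k => ?_
  rw [← diag, ← re_entry_self, entry_slice, re_entry_self]
  rfl

theorem hasSum_entry_reduced (k l : X → ℕ) :
    HasSum (fun m : ↥Xᶜ → ℕ => entry ρ (glue X m k) (glue X m l)) (entry (reduced X ρ) k l) := by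
  have h := (hρ.summable_slice X).hasSum.mapL
    (innerSL ℂ (ket k) ∘L ContinuousLinearMap.apply ℂ (Fock X) (ket l))
  simp only [ContinuousLinearMap.comp_apply (innerSL ℂ (ket k)), ContinuousLinearMap.apply_apply,
    innerSL_apply_apply, ← entry_eq_inner, entry_slice] at h
  exact h

variable {X}

theorem hasSum_mul_re_entry_reduced (f : (X → ℕ) → ℝ) (g : (X → ℕ) → X → ℕ) {t : ℝ}
    (h : HasSum (fun p : (X → ℕ) × (↥Xᶜ → ℕ) =>
      f p.1 * (entry ρ (glue X p.2 (g p.1)) (glue X p.2 p.1)).re) t) :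
    HasSum (fun k => f k * (entry (reduced X ρ) (g k) k).re) t :=
  h.prod_fiberwise fun k =>
    (Complex.hasSum_re (hρ.hasSum_entry_reduced X (g k) k)).mul_left (f k)

theorem hasSum_mul_diag_reduced (f : (X → ℕ) → ℝ) {t : ℝ}
    (h : HasSum (fun n : S → ℕ => f (fun x => n x) * diag ρ n) t) :
    HasSum (fun k => f k * diag (reduced X ρ) k) t := by
  simp only [← re_entry_self] at h ⊢
  refine hρ.hasSum_mul_re_entry_reduced f id (((glueEquiv X).hasSum_iff.2 h).congr_fun fun p => ?_)
  exact congrArg (fun k => f k * _) (funext fun x => (glue_coe p.2 p.1 x).symm)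

theorem occMean_reduced (x : X) : occMean (reduced X ρ) x = occMean ρ x :=
  (hρ.hasSum_mul_diag_reduced (fun k => k x) (hρ.hasSum_occMean x)).tsum_eq

theorem occSqMean_reduced (x : X) : occSqMean (reduced X ρ) x = occSqMean ρ x :=
  (hρ.hasSum_mul_diag_reduced (fun k => (k x : ℝ) ^ 2) (hρ.hasSum_occSqMean x)).tsum_eq

theorem hopExp_reduced [DecidableEq S] {x y : X} (hxy : x ≠ y) :
    hopExp (reduced X ρ) x y = hopExp ρ x y := by
  refine (hρ.hasSum_mul_re_entry_reduced (hopCoef x y) (hop x y) ?_).tsum_eq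
  have h := hρ.hasSum_hopExp (Subtype.coe_injective.ne hxy)
  refine ((glueEquiv X).hasSum_iff.2 h).congr_fun fun p => ?_
  simp only [Function.comp_apply, glueEquiv, Equiv.coe_fn_mk, hop_glue, hopCoef_glue]

variable [Fintype X]

theorem conserves_reduced : Conserves deg (reduced X ρ) := by
  classical
  intro k l hkl
  refine (hρ.hasSum_entry_reduced X k l).unique (hasSum_zero.congr_fun fun m => ?_)
  refine hρ.conserves fun h => hkl ?_
  rwa [deg_glue, deg_glue, add_left_inj] at h

variable (X)

protected theorem reduced : IsState (reduced X ρ) where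
  isPositive := isPositive_reduced X hρ.isPositive
  hasSum_diag := by
    have h := hρ.hasSum_mul_diag_reduced (X := X) (fun _ => 1) (t := 1)
    simp only [one_mul] at h
    exact h hρ.hasSum_diag
  conserves := hρ.conserves_reduced
  summable_deg_sq := by
    classical
    have hsum : Summable fun n : S → ℕ => (deg fun x : X => n x : ℝ) ^ 2 * diag ρ n := by
      refine hρ.summable_deg_sq.of_nonneg_of_le
        (fun n => mul_nonneg (sq_nonneg _) (hρ.diag_nonneg n)) fun n => ?_
      gcongr
      · exact hρ.diag_nonneg n
      · conv_rhs => rw [← (glueEquiv X).apply_symm_apply n]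
        exact (Nat.le_add_right _ _).trans (deg_glue _ _).ge
    exact (hρ.hasSum_mul_diag_reduced (fun k => (deg k : ℝ) ^ 2) hsum.hasSum).summable

end IsState

end Reduced

/-! ### Tensor products -/

section Tensor

variable {κ γ τ : Type}

theorem hasSum_mul_prod {ι ι' : Type*} {f : ι → ℂ} {g : ι' → ℂ} {s t : ℂ} (hf : HasSum f s)
    (hg : HasSum g t) : HasSum (fun i : ι × ι' => f i.1 * g i.2) (s * t) :=
  hf.mul hg (summable_mul_of_summable_norm hf.summable.norm hg.summable.norm)

theorem memℓp_two_of_summable {f : κ → ℂ} (h : Summable fun k => ‖f k‖ ^ 2) : Memℓp f 2 :=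
  memℓp_gen (by simpa using h)

/-- The product vector `φ ⊗ ψ` on `ℓ²(τ)`, where `τ` is identified with `κ × γ`. -/
def prodVec (e : κ × γ ≃ τ) (φ : L2 κ) (ψ : L2 γ) : L2 τ :=
  ⟨fun n => φ (e.symm n).1 * ψ (e.symm n).2, memℓp_two_of_summable <| by
    rw [← e.summable_iff]
    simpa [Function.comp_def, mul_pow] using
      (hasSum_norm_apply_sq φ).summable.mul_of_nonneg (hasSum_norm_apply_sq ψ).summable
        (fun _ => sq_nonneg _) fun _ => sq_nonneg _⟩

/-- `U = T ⊗ R` on `ℓ²(τ)`, where `τ` is identified with `κ × γ`. -/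
def IsTensor (e : κ × γ ≃ τ) (U : L2 τ →L[ℂ] L2 τ) (T : L2 κ →L[ℂ] L2 κ) (R : L2 γ →L[ℂ] L2 γ) :
    Prop :=
  ∀ k l m n, entry U (e (k, m)) (e (l, n)) = entry T k l * entry R m n

variable (e : κ × γ ≃ τ)

theorem prodVec_apply (φ : L2 κ) (ψ : L2 γ) (k : κ) (m : γ) :
    prodVec e φ ψ (e (k, m)) = φ k * ψ m := by
  change φ (e.symm (e (k, m))).1 * ψ (e.symm (e (k, m))).2 = φ k * ψ m
  rw [e.symm_apply_apply]

theorem inner_prodVec (φ φ' : L2 κ) (ψ ψ' : L2 γ) :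
    ⟪prodVec e φ ψ, prodVec e φ' ψ'⟫_ℂ = ⟪φ, φ'⟫_ℂ * ⟪ψ, ψ'⟫_ℂ := by
  have h := hasSum_mul_prod (lp.hasSum_inner (𝕜 := ℂ) φ φ') (lp.hasSum_inner (𝕜 := ℂ) ψ ψ')
  refine (e.hasSum_iff.2 (lp.hasSum_inner _ _)).unique (h.congr_fun fun ⟨k, m⟩ => ?_)
  simp only [Function.comp_apply, prodVec_apply, RCLike.inner_apply,
    map_mul]
  ring

variable {ι ι' : Type*} (b : HilbertBasis ι ℂ (L2 κ)) (c : HilbertBasis ι' ℂ (L2 γ))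

theorem orthonormal_prodVec : Orthonormal ℂ fun i : ι × ι' => prodVec e (b i.1) (c i.2) := by
  classical
  rw [orthonormal_iff_ite]
  rintro ⟨i, j⟩ ⟨i', j'⟩
  rw [inner_prodVec, orthonormal_iff_ite.1 b.orthonormal, orthonormal_iff_ite.1 c.orthonormal]
  simp only [Prod.mk.injEq, ite_and, ite_mul, one_mul, zero_mul]

theorem eq_zero_of_forall_inner_prodVec {ψ : L2 τ}
    (h : ∀ i j, ⟪prodVec e (b i) (c j), ψ⟫_ℂ = 0) : ψ = 0 := by
  have hsum := e.summable_iff.2 (hasSum_norm_apply_sq ψ).summable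
  let row (k : κ) : L2 γ := ⟨fun m => ψ (e (k, m)), memℓp_two_of_summable (hsum.prod_factor k)⟩
  have hrow (k) : HasSum (fun m => ‖ψ (e (k, m))‖ ^ 2) (‖row k‖ ^ 2) := hasSum_norm_apply_sq (row k)
  let col (j : ι') : L2 κ := ⟨fun k => ⟪c j, row k⟫_ℂ, memℓp_two_of_summable <| by
    refine (hsum.hasSum.prod_fiberwise hrow).summable.of_nonneg_of_le (fun _ => sq_nonneg _)
      fun k => ?_
    have := norm_inner_le_norm (𝕜 := ℂ) (c j) (row k)
    rw [c.orthonormal.1, one_mul] at this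
    gcongr⟩
  have hcol (j) : col j = 0 := by
    refine (hasSum_inner_smul b (col j)).unique (hasSum_zero.congr_fun fun i => ?_)
    rw [(?_ : ⟪b i, col j⟫_ℂ = 0), zero_smul]
    rw [← h i j]
    refine (lp.hasSum_inner (b i) (col j)).unique <|
      (e.hasSum_iff.2 (lp.hasSum_inner _ ψ)).prod_fiberwise fun k => ?_
    refine ((lp.hasSum_inner (c j) (row k)).mul_right (conj (b i k))).congr_fun fun m => ?_
    simp only [Function.comp_apply, prodVec_apply, RCLike.inner_apply, map_mul]
    ring
  have hrow0 (k) : row k = 0 := by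
    refine (hasSum_inner_smul c (row k)).unique (hasSum_zero.congr_fun fun j => ?_)
    rw [show ⟪c j, row k⟫_ℂ = 0 from congrArg (fun φ : L2 κ => φ k) (hcol j), zero_smul]
  ext n
  obtain ⟨⟨k, m⟩, rfl⟩ := e.surjective n
  exact congrArg (fun φ : L2 γ => φ m) (hrow0 k)

theorem exists_hilbertBasis_prodVec :
    ∃ B : HilbertBasis (ι × ι') ℂ (L2 τ), ∀ i j, B (i, j) = prodVec e (b i) (c j) := by
  refine ⟨HilbertBasis.mkOfOrthogonalEqBot (orthonormal_prodVec e b c) ?_, fun i j => by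
    rw [HilbertBasis.coe_mkOfOrthogonalEqBot]⟩
  refine (Submodule.eq_bot_iff _).2 fun ψ hψ => eq_zero_of_forall_inner_prodVec e b c fun i j => ?_
  exact (Submodule.mem_orthogonal _ _).1 hψ _ (Submodule.subset_span ⟨(i, j), rfl⟩)

theorem exists_isTensor {T : L2 κ →L[ℂ] L2 κ} {R : L2 γ →L[ℂ] L2 γ} {p : ι → ℝ} {q : ι' → ℝ}
    (hT : ∀ i, T (b i) = (p i : ℂ) • b i) (hR : ∀ j, R (c j) = (q j : ℂ) • c j)
    (hpq : Summable fun i : ι × ι' => p i.1 * q i.2) :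
    ∃ (U : L2 τ →L[ℂ] L2 τ) (B : HilbertBasis (ι × ι') ℂ (L2 τ)), IsTensor e U T R ∧
      ∀ i, U (B i) = ((p i.1 * q i.2 : ℝ) : ℂ) • B i := by
  obtain ⟨B, hB⟩ := exists_hilbertBasis_prodVec e b c
  obtain ⟨U, hU⟩ := exists_diagonal B hpq
  refine ⟨U, B, fun k l m n => ?_, hU⟩
  have h := hasSum_mul_prod (hasSum_mul_conj_of_eigenbasis b hT k l)
    (hasSum_mul_conj_of_eigenbasis c hR m n)
  refine (hasSum_mul_conj_of_eigenbasis B hU _ _).unique (h.congr_fun fun ⟨i, j⟩ => ?_)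
  rw [hB, prodVec_apply, prodVec_apply, map_mul, Complex.ofReal_mul]
  ring

end Tensor

/-! ### Product states -/

section ProductState

theorem tsum_ofReal_negMulLog_mul {ι ι' : Type*} {p : ι → ℝ} {q : ι' → ℝ} (hp0 : ∀ i, 0 ≤ p i)
    (hp : HasSum p 1) (hq0 : ∀ j, 0 ≤ q j) (hq : HasSum q 1) :
    ∑' i : ι × ι', ENNReal.ofReal (Real.negMulLog (p i.1 * q i.2)) =
      ∑' i, ENNReal.ofReal (Real.negMulLog (p i)) +
        ∑' j, ENNReal.ofReal (Real.negMulLog (q j)) := by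
  have hterm (i : ι) (j : ι') : ENNReal.ofReal (Real.negMulLog (p i * q j)) =
      ENNReal.ofReal (Real.negMulLog (p i)) * ENNReal.ofReal (q j) +
        ENNReal.ofReal (p i) * ENNReal.ofReal (Real.negMulLog (q j)) := by
    have hpi := Real.negMulLog_nonneg (hp0 i) (le_hasSum hp i fun _ _ => hp0 _)
    have hqj := Real.negMulLog_nonneg (hq0 j) (le_hasSum hq j fun _ _ => hq0 _)
    rw [Real.negMulLog_mul, mul_comm (q j), ENNReal.ofReal_add (mul_nonneg hpi (hq0 j))
      (mul_nonneg (hp0 i) hqj), ENNReal.ofReal_mul hpi, ENNReal.ofReal_mul (hp0 i)]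
  rw [ENNReal.tsum_prod']
  simp only [hterm, ENNReal.tsum_add, ENNReal.tsum_mul_left, ENNReal.tsum_mul_right,
    tsum_ofReal_eq_of_hasSum hp0 hp, tsum_ofReal_eq_of_hasSum hq0 hq, ENNReal.ofReal_one,
    mul_one, one_mul]

theorem IsTensor.diag {κ γ τ : Type} {e : κ × γ ≃ τ} {U : L2 τ →L[ℂ] L2 τ} {T : L2 κ →L[ℂ] L2 κ}
    {R : L2 γ →L[ℂ] L2 γ} (h : IsTensor e U T R) (hT : IsSelfAdjoint T) (k : κ) (m : γ) :
    diag U (e (k, m)) = diag T k * diag R m := by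
  rw [← re_entry_self, h, entry_self hT, Complex.re_ofReal_mul, re_entry_self]

variable {S : Type} {A : Set S}

theorem glue_compl (m : ↥Aᶜ → ℕ) (k : A → ℕ) :
    glue Aᶜ (fun x => k ⟨x, not_not.1 x.2⟩) m = glue A m k := by
  funext x
  by_cases hx : x ∈ A
  · rw [glue_of_mem _ _ hx, glue_of_notMem _ _ (not_not.2 hx)]
  · rw [glue_of_notMem _ _ hx, glue_of_mem _ _ hx]

theorem deg_glueEquiv [Fintype S] [Fintype A] [Fintype ↥Aᶜ] (k : A → ℕ) (m : ↥Aᶜ → ℕ) :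
    deg (glueEquiv A (k, m)) = deg k + deg m :=
  deg_glue m k

variable [Fintype S]

theorem IsState.exists_eigenbasis {ρ : Fock S →L[ℂ] Fock S} (hρ : IsState ρ) :
    ∃ (b : HilbertBasis (S → ℕ) ℂ (Fock S)) (p : (S → ℕ) → ℝ), (∀ i, 0 ≤ p i) ∧ HasSum p 1 ∧
      ∀ i, ρ (b i) = (p i : ℂ) • b i := by
  obtain ⟨b, -, hb⟩ := hρ.exists_graded_eigenbasis
  exact ⟨b, _, fun i => reApplyInnerSelf_nonneg hρ.isPositive (b i),
    hρ.hasSum_reApplyInnerSelf b, hb⟩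

theorem IsState.hasSum_entry_self {ρ : Fock S →L[ℂ] Fock S} (hρ : IsState ρ) :
    HasSum (fun n => entry ρ n n) 1 := by
  have h := hρ.hasSum_diag.mapL Complex.ofRealCLM
  rw [Complex.ofRealCLM_apply, Complex.ofReal_one] at h
  exact h.congr_fun fun n => entry_self hρ.isPositive.isSelfAdjoint n

variable (A) in
theorem IsState.hasSum_entry_reduced_compl {ρ : Fock S →L[ℂ] Fock S} (hρ : IsState ρ)
    (m n : ↥Aᶜ → ℕ) :
    HasSum (fun k : A → ℕ => entry ρ (glue A m k) (glue A n k)) (entry (reduced Aᶜ ρ) m n) := by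
  let e : ↥Aᶜᶜ ≃ A := Equiv.setCongr (compl_compl A)
  refine ((e.arrowCongr (.refl ℕ)).symm.hasSum_iff.2 (hρ.hasSum_entry_reduced Aᶜ m n)).congr_fun
    fun k => ?_
  rw [← glue_compl m, ← glue_compl n]
  rfl

variable {σ : Fock S →L[ℂ] Fock S} {T : Fock A →L[ℂ] Fock A} {R : Fock ↥Aᶜ →L[ℂ] Fock ↥Aᶜ}

section

variable [Fintype A] [Fintype ↥Aᶜ]

theorem IsTensor.isState (h : IsTensor (glueEquiv A) σ T R) (hσ : σ.IsPositive) (hT : IsState T)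
    (hR : IsState R) : IsState σ where
  isPositive := hσ
  hasSum_diag := by
    rw [← (glueEquiv A).hasSum_iff, ← mul_one (1 : ℝ)]
    exact (hT.hasSum_diag.mul hR.hasSum_diag (hT.hasSum_diag.summable.mul_of_nonneg
      hR.hasSum_diag.summable hT.diag_nonneg hR.diag_nonneg)).congr_fun
        fun ⟨k, m⟩ => h.diag hT.isPositive.isSelfAdjoint k m
  conserves n n' hn := by
    obtain ⟨⟨k, m⟩, rfl⟩ := (glueEquiv A).surjective n
    obtain ⟨⟨l, m'⟩, rfl⟩ := (glueEquiv A).surjective n'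
    rw [deg_glueEquiv, deg_glueEquiv] at hn
    rw [h, mul_eq_zero]
    by_cases hkl : deg k = deg l
    · exact Or.inr (hR.conserves fun hm => hn (by rw [hkl, hm]))
    · exact Or.inl (hT.conserves hkl)
  summable_deg_sq := by
    rw [← (glueEquiv A).summable_iff]
    have hT2 (k : A → ℕ) := mul_nonneg (sq_nonneg (deg k : ℝ)) (hT.diag_nonneg k)
    have hR2 (m : ↥Aᶜ → ℕ) := mul_nonneg (sq_nonneg (deg m : ℝ)) (hR.diag_nonneg m)
    refine (((hT.summable_deg_sq.mul_of_nonneg hR.hasSum_diag.summable hT2 hR.diag_nonneg).add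
      (hT.hasSum_diag.summable.mul_of_nonneg hR.summable_deg_sq hT.diag_nonneg hR2)).mul_left
        2).of_nonneg_of_le (fun ⟨k, m⟩ => ?_) fun ⟨k, m⟩ => ?_
    all_goals
      simp only [Function.comp_apply]
      rw [h.diag hT.isPositive.isSelfAdjoint]
      have hTR := mul_nonneg (hT.diag_nonneg k) (hR.diag_nonneg m)
    · positivity
    · rw [deg_glueEquiv, Nat.cast_add]
      linarith [mul_nonneg (sq_nonneg ((deg k : ℝ) - deg m)) hTR]

theorem IsState.exists_isTensor_entropy_eq (hT : IsState T) (hR : IsState R) :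
    ∃ σ : Fock S →L[ℂ] Fock S, IsState σ ∧ IsTensor (glueEquiv A) σ T R ∧
      entropy σ = entropy T + entropy R := by
  obtain ⟨b, p, hp0, hp, hb⟩ := hT.exists_eigenbasis
  obtain ⟨c, q, hq0, hq, hc⟩ := hR.exists_eigenbasis
  have hpq : HasSum (fun i : (A → ℕ) × (↥Aᶜ → ℕ) => p i.1 * q i.2) (1 * 1) :=
    hp.mul hq (hp.summable.mul_of_nonneg hq.summable hp0 hq0)
  rw [mul_one] at hpq
  have hpq0 (i : (A → ℕ) × (↥Aᶜ → ℕ)) : 0 ≤ p i.1 * q i.2 :=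
    mul_nonneg (hp0 i.1) (hq0 i.2)
  obtain ⟨σ, B, htensor, hB⟩ := exists_isTensor (glueEquiv A) b c hb hc hpq.summable
  refine ⟨σ, htensor.isState (isPositive_of_eigenbasis B hpq0 hB) hT hR, htensor, ?_⟩
  rw [entropy_eq_tsum B hpq0 hpq hB, entropy_eq_tsum b hp0 hp hb, entropy_eq_tsum c hq0 hq hc,
    tsum_ofReal_negMulLog_mul hp0 hp hq0 hq]

end

namespace IsTensor

variable (h : IsTensor (glueEquiv A) σ T R) (hσ : IsState σ)
include h hσ

theorem reduced_eq [Fintype ↥Aᶜ] (hR : IsState R) : reduced A σ = T := by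
  refine ext_of_entry fun k l => (hσ.hasSum_entry_reduced A k l).unique ?_
  have hsum := hR.hasSum_entry_self.mul_left (entry T k l)
  rw [mul_one] at hsum
  exact hsum.congr_fun fun m => h k l m m

theorem reduced_compl_eq [Fintype A] (hT : IsState T) : reduced Aᶜ σ = R := by
  refine ext_of_entry fun m n => (hσ.hasSum_entry_reduced_compl A m n).unique ?_
  have hsum := hT.hasSum_entry_self.mul_right (entry R m n)
  rw [one_mul] at hsum
  exact hsum.congr_fun fun k => h k k m n

end IsTensor

end ProductState

/-! ### Comparing a state with the product of its marginals -/

section Comparison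

variable {S : Type} {A : Set S} {ρ σ : Fock S →L[ℂ] Fock S}

theorem deg_restrict_add_single [Fintype A] [DecidableEq S] (n : S → ℕ) (x : S)
    [Decidable (x ∈ A)] :
    deg (fun a : A => (n + (Pi.single x 1 : S → ℕ)) a) =
      deg (fun a : A => n a) + if x ∈ A then 1 else 0 := by
  simp only [deg, Pi.add_apply, Finset.sum_add_distrib, Pi.single_apply]
  congr 1
  split_ifs with hx
  · rw [Finset.sum_eq_single ⟨x, hx⟩ (fun a _ ha => if_neg fun h => ha (Subtype.ext h))
      fun h => absurd (Finset.mem_univ _) h, if_pos rfl]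
  · exact Finset.sum_eq_zero fun a _ => if_neg fun h : (a : S) = x => hx (h ▸ a.2)

namespace IsTensor

variable {T : Fock A →L[ℂ] Fock A} {R : Fock ↥Aᶜ →L[ℂ] Fock ↥Aᶜ}

theorem entry_eq_zero_of_deg_ne [Fintype A] (h : IsTensor (glueEquiv A) σ T R)
    (hT : Conserves deg T) {n n' : S → ℕ}
    (hn : deg (fun a : A => n a) ≠ deg fun a : A => n' a) : entry σ n n' = 0 := by
  obtain ⟨⟨k, m⟩, rfl⟩ := (glueEquiv A).surjective n
  obtain ⟨⟨l, m'⟩, rfl⟩ := (glueEquiv A).surjective n'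
  have hrestrict (k : A → ℕ) (m : ↥Aᶜ → ℕ) : (fun a : A => glueEquiv A (k, m) a) = k :=
    funext fun a => glue_coe m k a
  rw [hrestrict, hrestrict] at hn
  rw [h, hT hn, zero_mul]

theorem hopExp_eq_zero [Fintype A] [DecidableEq S] (h : IsTensor (glueEquiv A) σ T R)
    (hT : Conserves deg T) {x y : S} (hxy : ¬(x ∈ A ↔ y ∈ A)) : hopExp σ x y = 0 := by
  classical
  refine (tsum_congr fun n => ?_).trans tsum_zero
  by_cases hn : n x = 0
  · rw [hopCoef_eq_zero hn, zero_mul]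
  obtain ⟨n, rfl⟩ := exists_eq_add_single hn
  rw [hop_add_single, h.entry_eq_zero_of_deg_ne hT, Complex.zero_re, mul_zero]
  rw [deg_restrict_add_single, deg_restrict_add_single, ne_eq, Nat.add_left_cancel_iff]
  split_ifs <;> simp_all

end IsTensor

variable [Fintype S]

namespace IsState

variable (hρ : IsState ρ) (hσ : IsState σ) {X : Set S} (hX : reduced X σ = reduced X ρ)
include hρ hσ hX

theorem occMean_eq_of_reduced_eq {x : S} (hx : x ∈ X) : occMean σ x = occMean ρ x := by
  rw [← hσ.occMean_reduced ⟨x, hx⟩, hX, hρ.occMean_reduced ⟨x, hx⟩]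

theorem occSqMean_eq_of_reduced_eq {x : S} (hx : x ∈ X) : occSqMean σ x = occSqMean ρ x := by
  rw [← hσ.occSqMean_reduced ⟨x, hx⟩, hX, hρ.occSqMean_reduced ⟨x, hx⟩]

theorem hopExp_eq_of_reduced_eq [DecidableEq S] {x y : S} (hx : x ∈ X) (hy : y ∈ X)
    (hxy : x ≠ y) : hopExp σ x y = hopExp ρ x y := by
  have hxy' : (⟨x, hx⟩ : X) ≠ ⟨y, hy⟩ := fun h => hxy (congrArg Subtype.val h)
  rw [← hσ.hopExp_reduced hxy', hX, hρ.hopExp_reduced hxy']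

end IsState

theorem IsTensor.abs_hopExp_sub_le [DecidableEq S] [∀ x, Decidable (x ∈ A)] (hρ : IsState ρ)
    (hσ : IsState σ) (h : IsTensor (glueEquiv A) σ (reduced A ρ) (reduced Aᶜ ρ)) {x y : S}
    (hxy : x ≠ y) :
    |hopExp ρ x y - hopExp σ x y| ≤
      if x ∈ A ↔ y ∈ A then 0 else (occMean ρ x + occMean ρ y) / 2 := by
  split_ifs with hA
  · rw [abs_nonpos_iff, sub_eq_zero, eq_comm]
    by_cases hx : x ∈ A
    · exact hρ.hopExp_eq_of_reduced_eq hσ (h.reduced_eq hσ (hρ.reduced Aᶜ)) hx (hA.1 hx) hxy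
    · exact hρ.hopExp_eq_of_reduced_eq hσ (h.reduced_compl_eq hσ (hρ.reduced A)) hx
        (fun hy => hx (hA.2 hy)) hxy
  · rw [h.hopExp_eq_zero (hρ.reduced A).conserves hA, sub_zero]
    exact hρ.abs_hopExp_le hxy

variable (G : SimpleGraph S) [DecidableRel G.Adj]

/-- The edge boundary of a set `A` of vertices; each boundary edge is counted once, oriented from
`A` to its complement. -/
def edgeBoundary (A : Set S) : Finset G.Dart :=
  open Classical in Finset.univ.filter fun d => d.fst ∈ A ∧ d.snd ∉ A

variable {G} in
theorem mem_edgeBoundary {d : G.Dart} : d ∈ edgeBoundary G A ↔ d.fst ∈ A ∧ d.snd ∉ A := by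
  simp only [edgeBoundary, Finset.mem_filter, Finset.mem_univ, true_and]

theorem sum_crossing_eq (A : Set S) [∀ x, Decidable (x ∈ A)] {f : S → S → ℝ}
    (hf : ∀ x y, f x y = f y x) :
    ∑ d : G.Dart, (if d.fst ∈ A ↔ d.snd ∈ A then 0 else f d.fst d.snd) =
      2 * ∑ d ∈ edgeBoundary G A, f d.fst d.snd := by
  let F (d : G.Dart) : ℝ := if d.fst ∈ A ∧ d.snd ∉ A then f d.fst d.snd else 0
  have hF : ∑ d, F d = ∑ d ∈ edgeBoundary G A, f d.fst d.snd := by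
    simp only [F, edgeBoundary, Finset.sum_filter]
    congr!
  have hsymm : ∑ d : G.Dart, F d.symm = ∑ d, F d :=
    Equiv.sum_comp SimpleGraph.Dart.symm_involutive.toPerm F
  have hsplit (d : G.Dart) :
      (if d.fst ∈ A ↔ d.snd ∈ A then 0 else f d.fst d.snd) = F d + F d.symm := by
    have : F d.symm = if d.snd ∈ A ∧ d.fst ∉ A then f d.snd d.fst else 0 := rfl
    rw [this, hf d.snd]
    by_cases hx : d.fst ∈ A <;> by_cases hy : d.snd ∈ A <;> simp [F, hx, hy]
  rw [Finset.sum_congr rfl fun d _ => hsplit d, Finset.sum_add_distrib, hsymm, hF, two_mul]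

theorem IsTensor.energy_sub_le [DecidableEq S] (J U μ : ℝ) (hρ : IsState ρ)
    (hσ : IsState σ) (h : IsTensor (glueEquiv A) σ (reduced A ρ) (reduced Aᶜ ρ)) :
    energy G J U μ σ - energy G J U μ ρ ≤
      |J| * ∑ d ∈ edgeBoundary G A, (occMean ρ d.fst + occMean ρ d.snd) := by
  classical
  have hA := h.reduced_eq hσ (hρ.reduced Aᶜ)
  have hAc := h.reduced_compl_eq hσ (hρ.reduced A)
  have hmean (x : S) : occMean σ x = occMean ρ x := by
    by_cases hx : x ∈ A
    exacts [hρ.occMean_eq_of_reduced_eq hσ hA hx, hρ.occMean_eq_of_reduced_eq hσ hAc hx]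
  have hsqMean (x : S) : occSqMean σ x = occSqMean ρ x := by
    by_cases hx : x ∈ A
    exacts [hρ.occSqMean_eq_of_reduced_eq hσ hA hx, hρ.occSqMean_eq_of_reduced_eq hσ hAc hx]
  calc energy G J U μ σ - energy G J U μ ρ
      = J * ∑ d : G.Dart, (hopExp ρ d.fst d.snd - hopExp σ d.fst d.snd) := by
        simp only [energy, hmean, hsqMean, Finset.sum_sub_distrib]
        ring
    _ ≤ |J| * ∑ d : G.Dart, |hopExp ρ d.fst d.snd - hopExp σ d.fst d.snd| := by
        refine (le_abs_self _).trans ?_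
        rw [abs_mul]
        gcongr
        exact Finset.abs_sum_le_sum_abs _ _
    _ ≤ |J| * ∑ d : G.Dart, if d.fst ∈ A ↔ d.snd ∈ A then 0 else
          (occMean ρ d.fst + occMean ρ d.snd) / 2 := by
        gcongr with d
        exact h.abs_hopExp_sub_le hρ hσ d.fst_ne_snd
    _ = |J| * ∑ d ∈ edgeBoundary G A, (occMean ρ d.fst + occMean ρ d.snd) := by
        rw [sum_crossing_eq G A (f := fun x y => (occMean ρ x + occMean ρ y) / 2)
          fun x y => by rw [add_comm], ← Finset.sum_div, mul_div_cancel₀ _ two_ne_zero]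

end Comparison

/-! ### The area law on a finite graph -/

section AreaLaw

variable {S : Type} [Fintype S] [DecidableEq S] {G : SimpleGraph S} [DecidableRel G.Adj]
  {J U μ β : ℝ} {b : HilbertBasis (S → ℕ) ℂ (Fock S)} {ε : (S → ℕ) → ℝ}
  {ρ : Fock S →L[ℂ] Fock S}

theorem IsEnergyBasis.mutualInformation_le (hb : IsEnergyBasis G J U μ b ε) (hU : 0 < U)
    (hβ : 0 < β) (hρ : IsGibbsState (hamiltonian G J U μ) β ρ) (A : Set S) :
    mutualInformation A ρ ≤
      β * (|J| * ∑ d ∈ edgeBoundary G A, (occMean ρ d.fst + occMean ρ d.snd)) := by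
  classical
  have hstate := hb.isState_gibbs hU hβ hρ
  have hA := hstate.reduced A
  have hAc := hstate.reduced Aᶜ
  obtain ⟨σ, hσ, htensor, hentropy⟩ := hA.exists_isTensor_entropy_eq hAc
  have hvar := hb.entropy_le hU hβ hσ
  rw [hentropy, ENNReal.toReal_add hA.entropy_ne_top hAc.entropy_ne_top] at hvar
  calc mutualInformation A ρ
      ≤ β * (energy G J U μ σ - energy G J U μ ρ) := by
        rw [mutualInformation, hb.entropy_gibbs_eq hU hβ hρ]
        linarith
    _ ≤ _ := mul_le_mul_of_nonneg_left (htensor.energy_sub_le G J U μ hstate hσ) hβ.le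

theorem IsEnergyBasis.energy_density_le [Nonempty S] (hb : IsEnergyBasis G J U μ b ε) (hU : 0 < U)
    (hβ : 0 < β) (hρ : IsGibbsState (hamiltonian G J U μ) β ρ) {Δ : ℕ}
    (hΔ : ∀ x, G.degree x ≤ Δ) {n : ℝ} (hn : ∀ x, occMean ρ x = n) :
    β * (U / 2 * (n ^ 2 - n) - (Δ * |J| + μ) * n) ≤ Real.log 2 * (n + 1) := by
  have hstate := hb.isState_gibbs hU hβ hρ
  have henergy := mul_le_mul_of_nonneg_left (hstate.sum_occMean_le_energy G J μ hΔ hU.le) hβ.le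
  have hn0 (x : S) : 0 ≤ Real.log 2 * (occMean ρ x + 1) :=
    mul_nonneg (Real.log_nonneg one_le_two) (by linarith [hstate.occMean_nonneg x])
  have hentropy := ENNReal.toReal_le_of_le_ofReal (Finset.sum_nonneg fun x _ => hn0 x)
    hstate.entropy_le
  rw [hb.entropy_gibbs_eq hU hβ hρ] at hentropy
  have hlog := Real.log_nonneg (hb.one_le_partitionFunction hU hβ)
  simp only [hn, Finset.sum_const, Finset.card_univ, nsmul_eq_mul] at henergy hentropy
  refine le_of_mul_le_mul_left ?_ (Nat.cast_pos.2 (Fintype.card_pos (α := S)))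
  linarith

theorem mul_density_le {β U g n : ℝ} (hβ : 0 < β) (hU : 0 < U) (hg : 0 ≤ g)
    (h : β * (U / 2 * (n ^ 2 - n) - g * n) ≤ Real.log 2 * (n + 1)) :
    β * n ≤ 4 * ((g + 1) / U + 1 / 2) * max 1 β := by
  have hM1 : 1 ≤ max 1 β := le_max_left _ _
  have hMβ : β ≤ max 1 β := le_max_right _ _
  generalize max 1 β = M at hM1 hMβ
  have hpos : 0 ≤ M * ((g + 1) / U) := by positivity
  rcases le_or_gt n 1 with hn | hn
  · linarith [mul_le_of_le_one_right hβ.le hn]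
  have hlinear : β * (U / 2 * (n - 1) - g) ≤ 2 := by
    have hlog : Real.log 2 ≤ 1 := by linarith [Real.log_two_lt_d9]
    refine le_of_mul_le_mul_left (a := n) ?_ (by linarith)
    calc n * (β * (U / 2 * (n - 1) - g)) = β * (U / 2 * (n ^ 2 - n) - g * n) := by ring
      _ ≤ Real.log 2 * (n + 1) := h
      _ ≤ 1 * (n + 1) := by gcongr
      _ ≤ n * 2 := by linarith
  calc β * n = β + 2 / U * (β * (U / 2 * (n - 1) - g)) + 2 * (β * (g / U)) := by
        field_simp
        ring
    _ ≤ M + 2 / U * 2 + 2 * (M * (g / U)) := by gcongr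
    _ ≤ M + 4 * (M * (1 / U)) + 4 * (M * (g / U)) := by
        have hMU : 1 * (1 / U) ≤ M * (1 / U) := by gcongr
        have hMg : 0 ≤ M * (g / U) := by positivity
        linarith [show 2 / U * 2 = 4 * (1 * (1 / U)) by ring]
    _ ≤ 4 * ((g + 1) / U + 1 / 2) * M := by
        rw [add_div]
        linarith

theorem IsEnergyBasis.mul_occMean_le (hb : IsEnergyBasis G J U μ b ε)
    (hG : ∀ x y, ∃ φ : G ≃g G, φ x = y) {Δ : ℕ} (hΔ : ∀ x, G.degree x ≤ Δ) (hU : 0 < U)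
    (hβ : 0 < β) (hμ : 0 ≤ Δ * |J| + μ) (hρ : IsGibbsState (hamiltonian G J U μ) β ρ) (x : S) :
    β * occMean ρ x ≤ 4 * ((Δ * |J| + μ + 1) / U + 1 / 2) * max 1 β := by
  have : Nonempty S := ⟨x⟩
  refine mul_density_le hβ hU hμ (hb.energy_density_le hU hβ hρ hΔ fun y => ?_)
  obtain ⟨φ, rfl⟩ := hG x y
  exact occMean_apply_eq hρ φ x

end AreaLaw

/-! ### Geometry of the periodic box -/

section Box

variable {d L : ℕ}

theorem boxGraph_adj {x y : Box d L} : (boxGraph d L).Adj x y ↔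
    x ≠ y ∧ ((∃ i, y = x + Pi.single i 1) ∨ ∃ i, x = y + Pi.single i 1) := Iff.rfl

theorem exists_boxGraph_iso (x y : Box d L) : ∃ φ : boxGraph d L ≃g boxGraph d L, φ x = y := by
  refine ⟨⟨Equiv.addRight (y - x), fun {u v} => ?_⟩, add_sub_cancel x y⟩
  simp only [boxGraph_adj, Equiv.coe_addRight, ne_eq, add_left_inj, add_right_comm _ (y - x)]

variable [NeZero L]

theorem boxGraph_degree_le [DecidableRel (boxGraph d L).Adj] (x : Box d L) :
    (boxGraph d L).degree x ≤ 2 * d := by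
  have hsubset : (boxGraph d L).neighborFinset x ⊆
      Finset.univ.image (fun i : Fin d => x + Pi.single i 1) ∪
        Finset.univ.image (fun i : Fin d => x - Pi.single i 1) := by
    intro y hy
    rw [SimpleGraph.mem_neighborFinset, boxGraph_adj] at hy
    simp only [Finset.mem_union, Finset.mem_image, Finset.mem_univ, true_and]
    exact hy.2.imp (fun ⟨i, hi⟩ => ⟨i, hi.symm⟩) fun ⟨i, hi⟩ => ⟨i, (eq_sub_of_add_eq hi.symm).symm⟩
  calc (boxGraph d L).degree x ≤ _ := Finset.card_le_card hsubset
    _ ≤ _ := Finset.card_union_le _ _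
    _ ≤ d + d := add_le_add (Finset.card_image_le.trans_eq (Finset.card_fin d))
        (Finset.card_image_le.trans_eq (Finset.card_fin d))
    _ = 2 * d := (two_mul d).symm

theorem eq_natCast_of_val_lt_of_not_val_add_one_lt {z : ZMod L} {w : ℕ} (hw : w ≤ L)
    (h : z.val < w) (h' : ¬(z + 1).val < w) : z = ((w - 1 : ℕ) : ZMod L) := by
  have hval : z.val = w - 1 := by
    by_contra hne
    have hadd : z + 1 = ((z.val + 1 : ℕ) : ZMod L) := by
      rw [Nat.cast_add, ZMod.natCast_zmod_val, Nat.cast_one]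
    rw [hadd, ZMod.val_natCast_of_lt (by omega)] at h'
    omega
  rw [← hval, ZMod.natCast_zmod_val]

theorem eq_zero_of_val_lt_of_not_val_sub_one_lt {z : ZMod L} {w : ℕ} (h : z.val < w)
    (h' : ¬(z - 1).val < w) : z = 0 := by
  by_contra hz
  have hval : z.val ≠ 0 := mt (ZMod.val_eq_zero z).1 hz
  have hsub : z - 1 = ((z.val - 1 : ℕ) : ZMod L) := by
    rw [Nat.cast_sub (by omega), ZMod.natCast_zmod_val, Nat.cast_one]
  have hL := ZMod.val_lt z
  rw [hsub, ZMod.val_natCast_of_lt (by omega)] at h'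
  omega

theorem eq_of_adj_of_mem_slab {j : Fin d} {s : ZMod L} {w : ℕ} (hw : w ≤ L) {x y : Box d L}
    (hxy : (boxGraph d L).Adj x y) (hx : x ∈ slab j s w) (hy : y ∉ slab j s w) :
    (x j = ((w - 1 : ℕ) : ZMod L) + s ∧ y = x + Pi.single j 1) ∨
      (x j = s ∧ y = x - Pi.single j 1) := by
  have hlayer : y j ≠ x j := fun h => hy (by rwa [slab, Set.mem_ofPred_eq, h])
  obtain ⟨-, ⟨i, rfl⟩ | ⟨i, hi⟩⟩ := boxGraph_adj.1 hxy
  · obtain rfl : i = j := by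
      by_contra hij
      exact hlayer (by rw [Pi.add_apply, Pi.single_eq_of_ne' hij, add_zero])
    rw [slab, Set.mem_ofPred_eq, Pi.add_apply, Pi.single_eq_same, add_sub_right_comm] at hy
    exact Or.inl ⟨eq_add_of_sub_eq (eq_natCast_of_val_lt_of_not_val_add_one_lt hw hx hy), rfl⟩
  · obtain rfl : y = x - Pi.single i 1 := eq_sub_of_add_eq hi.symm
    obtain rfl : i = j := by
      by_contra hij
      exact hlayer (by rw [Pi.sub_apply, Pi.single_eq_of_ne' hij, sub_zero])
    rw [slab, Set.mem_ofPred_eq, Pi.sub_apply, Pi.single_eq_same, sub_right_comm] at hy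
    exact Or.inr ⟨sub_eq_zero.1 (eq_zero_of_val_lt_of_not_val_sub_one_lt hx hy), rfl⟩

theorem card_layer (j : Fin d) (c : ZMod L) :
    (Finset.univ.filter fun x : Box d L => x j = c).card = L ^ (d - 1) := by
  have h := Fintype.card_filter_piFinset_const_eq_of_mem Finset.univ j (Finset.mem_univ c)
  rwa [Fintype.piFinset_univ, Finset.card_univ, ZMod.card, Fintype.card_fin] at h

theorem card_edgeBoundary_slab_le [DecidableRel (boxGraph d L).Adj] (j : Fin d) (s : ZMod L)
    {w : ℕ} (hw : w ≤ L) :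
    (edgeBoundary (boxGraph d L) (slab j s w)).card ≤ 2 * L ^ (d - 1) := by
  let layer (c : ZMod L) : Finset (Box d L) := Finset.univ.filter fun x => x j = c
  have hsubset : (edgeBoundary (boxGraph d L) (slab j s w)).image SimpleGraph.Dart.toProd ⊆
      (layer (((w - 1 : ℕ) : ZMod L) + s)).image (fun x => (x, x + Pi.single j 1)) ∪
        (layer s).image fun x => (x, x - Pi.single j 1) := by
    intro p hp
    obtain ⟨a, ha, rfl⟩ := Finset.mem_image.1 hp
    obtain ⟨hfst, hsnd⟩ := mem_edgeBoundary.1 ha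
    simp only [layer, Finset.mem_union, Finset.mem_image, Finset.mem_filter, Finset.mem_univ,
      true_and]
    exact (eq_of_adj_of_mem_slab hw a.adj hfst hsnd).imp
      (fun h => ⟨a.fst, h.1, Prod.ext rfl h.2.symm⟩) fun h => ⟨a.fst, h.1, Prod.ext rfl h.2.symm⟩
  rw [← Finset.card_image_of_injective _ SimpleGraph.Dart.toProd_injective, two_mul]
  exact (Finset.card_le_card hsubset).trans ((Finset.card_union_le _ _).trans
    (add_le_add (Finset.card_image_le.trans_eq (card_layer j _))
      (Finset.card_image_le.trans_eq (card_layer j s))))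

theorem const_le_areaConst (d : ℕ) {J U μ : ℝ} (hU : 0 < U) (hμ : 0 ≤ 2 * (d : ℝ) * |J| + μ) :
    16 * |J| * ((2 * d * |J| + μ + 1) / U + 1 / 2) ≤ areaConst d J U μ := by
  have hG : 0 ≤ 2 * (d : ℝ) * |J| + 1 + μ := by linarith
  rw [areaConst, add_right_comm _ μ 1]
  refine mul_le_mul_of_nonneg_left ?_ (by positivity)
  rw [add_assoc (_ + _)]
  exact le_add_of_nonneg_left (by positivity)

theorem mul_card_edgeBoundary_slab_le [DecidableRel (boxGraph d L).Adj] (j : Fin d) (s : ZMod L)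
    {w : ℕ} (hw : w ≤ L) {J U μ : ℝ} (hU : 0 < U) (hμ : 0 ≤ ((2 * d : ℕ) : ℝ) * |J| + μ) (β : ℝ) :
    8 * |J| * ((((2 * d : ℕ) : ℝ) * |J| + μ + 1) / U + 1 / 2) * max 1 β *
        (edgeBoundary (boxGraph d L) (slab j s w)).card ≤
      areaConst d J U μ * max 1 β * (L : ℝ) ^ (d - 1) := by
  have hcard : ((edgeBoundary (boxGraph d L) (slab j s w)).card : ℝ) ≤ 2 * (L : ℝ) ^ (d - 1) := by
    exact_mod_cast card_edgeBoundary_slab_le j s hw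
  push_cast at hμ ⊢
  calc _ ≤ 8 * |J| * ((2 * d * |J| + μ + 1) / U + 1 / 2) * max 1 β * (2 * (L : ℝ) ^ (d - 1)) := by
        gcongr
    _ = 16 * |J| * ((2 * d * |J| + μ + 1) / U + 1 / 2) * max 1 β * (L : ℝ) ^ (d - 1) := by ring
    _ ≤ areaConst d J U μ * max 1 β * (L : ℝ) ^ (d - 1) := by
        gcongr
        exact const_le_areaConst d hU hμ

end Box

end BoseHubbard

end

open BoseHubbard in
theorem theorem1_general {S : Type} [Fintype S] [DecidableEq S] (G : SimpleGraph S)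
    [DecidableRel G.Adj] (hG : ∀ x y, ∃ φ : G ≃g G, φ x = y) {Δ : ℕ} (hΔ : ∀ x, G.degree x ≤ Δ)
    {J U μ β : ℝ} (hU : 0 < U) (hβ : 0 < β) (hμ : 0 ≤ Δ * |J| + μ) (A : Set S) :
    (∃ ρ : Fock S →L[ℂ] Fock S, IsGibbsState (hamiltonian G J U μ) β ρ) ∧
    ∀ ρ : Fock S →L[ℂ] Fock S, IsGibbsState (hamiltonian G J U μ) β ρ →
      entropy ρ ≠ ⊤ ∧ entropy (reduced A ρ) ≠ ⊤ ∧ entropy (reduced Aᶜ ρ) ≠ ⊤ ∧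
        mutualInformation A ρ ≤
          8 * |J| * ((Δ * |J| + μ + 1) / U + 1 / 2) * max 1 β * (edgeBoundary G A).card := by
  classical
  obtain ⟨b, ε, hb⟩ := exists_isEnergyBasis G J U μ
  refine ⟨hb.exists_isGibbsState hU hβ, fun ρ hρ => ?_⟩
  have hstate := hb.isState_gibbs hU hβ hρ
  refine ⟨hstate.entropy_ne_top, (hstate.reduced A).entropy_ne_top,
    (hstate.reduced Aᶜ).entropy_ne_top, ?_⟩
  have hdensity := hb.mul_occMean_le hG hΔ hU hβ hμ hρ
  calc mutualInformation A ρ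
      ≤ β * (|J| * ∑ d ∈ edgeBoundary G A, (occMean ρ d.fst + occMean ρ d.snd)) :=
        hb.mutualInformation_le hU hβ hρ A
    _ = |J| * ∑ d ∈ edgeBoundary G A, (β * occMean ρ d.fst + β * occMean ρ d.snd) := by
        simp only [← mul_add, ← Finset.mul_sum]
        ring
    _ ≤ |J| * ((edgeBoundary G A).card •
          (2 * (4 * ((Δ * |J| + μ + 1) / U + 1 / 2) * max 1 β))) := by
        gcongr
        exact Finset.sum_le_card_nsmul _ _ _ fun d _ => by linarith [hdensity d.fst, hdensity d.snd]
    _ = 8 * |J| * ((Δ * |J| + μ + 1) / U + 1 / 2) * max 1 β * (edgeBoundary G A).card := by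
        rw [nsmul_eq_mul]
        ring

open BoseHubbard in
theorem theorem1 (d L : ℕ) [NeZero L] (J U μ β : ℝ) (hU : 0 < U) (hμ : 0 < μ) (hβ : 0 < β)
    (j : Fin d) (s : ZMod L) (LA : ℕ) (hLA : 1 ≤ LA) (hLAL : LA ≤ L) :
    (∃ ρ : Fock (Box d L) →L[ℂ] Fock (Box d L),
      IsGibbsState (hamiltonian (boxGraph d L) J U μ) β ρ) ∧
    ∀ ρ : Fock (Box d L) →L[ℂ] Fock (Box d L),
      IsGibbsState (hamiltonian (boxGraph d L) J U μ) β ρ →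
        entropy ρ ≠ ⊤ ∧
        entropy (reduced (slab j s LA) ρ) ≠ ⊤ ∧
        entropy (reduced (slab j s LA)ᶜ ρ) ≠ ⊤ ∧
        mutualInformation (slab j s LA) ρ ≤
          areaConst d J U μ * max 1 β * (L : ℝ) ^ (d - 1) := by
  classical
  have hg : 0 ≤ ((2 * d : ℕ) : ℝ) * |J| + μ := by positivity
  obtain ⟨hexists, hall⟩ := theorem1_general (boxGraph d L) exists_boxGraph_iso boxGraph_degree_le
    hU hβ hg (slab j s LA)
  refine ⟨hexists, fun ρ hρ => ?_⟩
  obtain ⟨hρ, hA, hB, hI⟩ := hall ρ hρ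
  exact ⟨hρ, hA, hB, hI.trans (mul_card_edgeBoundary_slab_le j s hLAL hU hg β)⟩
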